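/- Let $0\le d_1\le d$ and $n$ be integers, $\lambda\ge 0$, $M>0$, $L\ge 0$. For $y\in\mathbb{R}^d$ put $$\|y\|^2:=\lambda\sum_{i=1}^{d_1}y_i^2+\sum_{j=d_1+1}^{d}\hat\delta_{y_j,0},\qquad \hat\delta_{t,0}:=4t^2\ \text{ if } |t|\le\tfrac12,\qquad \hat\delta_{t,0}:=1\ \text{ if } |t|>\tfrac12,$$ and let $\|\cdot\|_2$ be the Euclidean norm. For probability measures $f,\hat f$ on $\mathbb{R}^d$ let $$\hat W_2(f,\hat f):=\inf_{\pi}\,\mathbb{E}_{(y,\hat y)\sim\pi}\big[\|y-\hat y\|^2\big]^{1/2},$$ where the infimum is over all couplings $\pi$ of $f$ and $\hat f$, and let $W_2$ be the same quantity with $\|\cdot\|_2$ in place of $\|\cdot\|$. Let $D\subseteq\mathbb{R}^n$ be measurable and let $\nu$ be a probability measure on $D$. Let $y_x=y(x;\omega)$ and $\hat y_x=\hat y(x;\hat\omega)$, $x\in D$, be jointly measurable $\mathbb{R}^d$-valued random fields over probability spaces $(\Omega,P)$ and $(\hat\Omega,\hat P)$, and let $f_x,\hat f_x$ be the laws of $y_x,\hat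 y_x$. Assume that, for all $x,\tilde x\in D$, almost surely $\max(\|y_x\|,\|y_x\|_2)\le\sqrt M$ and $\max(\|\hat y_x\|,\|\hat y_x\|_2)\le\sqrt M$, and $$\hat W_2(f_x,f_{\tilde x})\le L\|x-\tilde x\|_2,\qquad \hat W_2(\hat f_x,\hat f_{\tilde x})\le L\|x-\tilde x\|_2 .$$ Put $\hat W_2^2(y_x,\hat y_x):=\int_D\hat W_2^2(f_x,\hat f_x)\,\nu(\mathrm{d}x)$. Let $N\ge 1$ and $\delta\ge 0$. Let $x_1,\dots,x_N$ be sampled independently from $\nu$, and let $y_i=y(x_i;\omega_i)$, $\hat y_i=\hat y(x_i;\hat\omega_i)$, where $(x_i,\omega_i)_{i\le N}$ are i.i.d. with law $\nu\otimes P$ and $(x_i,\hat\omega_i)_{i\le N}$ are i.i.d. with law $\nu\otimes\hat P$. Let $\nu^{\mathrm e}$ be the empirical distribution of $x_1,\dots,x_N$, let $N(x,\delta)$ be the number of indices $j$ with $\|x_j-x\|_2\le\delta$, let $f^{\mathrm e}_{x,\delta}$ and $\hat f^{\mathrm e}_{x,\delta}$ be the empirical distributions of the $y_j$, respectively the $\hat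 y_j$, over these indices $j$, and put $$\hat W^{2,\mathrm e}_{2,\delta}(y_x,\hat y_x):=\int_D\hat W_2^2\big(f^{\mathrm e}_{x,\delta},\hat f^{\mathrm e}_{x,\delta}\big)\,\nu^{\mathrm e}(\mathrm{d}x).$$ Then there is a constant $K>0$ such that $\hat W_2(\mu,\mu')\le K\,W_2(\mu,\mu')$ for all probability measures $\mu,\mu'$ on $\mathbb{R}^d$ that are concentrated on $\{y:\max(\|y\|,\|y\|_2)\le\sqrt M\}$; and for every such $K$ $$\mathbb{E}\Big[\big|\hat W_2^2(y_x,\hat y_x)-\hat W^{2,\mathrm e}_{2,\delta}(y_x,\hat y_x)\big|\Big]\le\frac{4M}{\sqrt N}+8CKM\,\mathbb{E}\Big[\int_D h\big(N(x,\delta),d\big)\,\nu^{\mathrm e}(\mathrm{d}x)\Big]+8\sqrt M\,L\,\delta,$$ where all the integrals exist, $C>0$ is a constant that depends only on $d$, and $$h(m,d):=2m^{-1/4}\log(1+m)^{1/2}\ \text{ for } d\le 4,\qquad h(m,d):=2m^{-1/d}\ \text{ for } d>4 .$$ -/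

import Mathlib

open MeasureTheory ProbabilityTheory

universe u v w

/-- The Euclidean space `ℝᵐ`. -/
abbrev Euc (m : ℕ) : Type := EuclideanSpace ℝ (Fin m)

noncomputable section

/-- The function `δ̂_{t,0}`: it is `4 t²` for `|t| ≤ 1/2` and `1` for `|t| > 1/2`. -/
def deltaHat (t : ℝ) : ℝ := if |t| ≤ 1 / 2 then 4 * t ^ 2 else 1

/-- The generalized norm on `ℝᵈ` of mixed vectors, where the first `d₁` components are the
continuous ones and the remaining ones the categorical ones:
`‖y‖² = lam * ∑_{i ≤ d₁} y_i² + ∑_{i > d₁} δ̂_{y_i,0}`. -/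
def genNorm {d : ℕ} (d₁ : ℕ) (lam : ℝ) (y : Euc d) : ℝ :=
  Real.sqrt (∑ i : Fin d, if (i : ℕ) < d₁ then lam * y i ^ 2 else deltaHat (y i))

/-- `π` is a coupling of `μ` and `μ'`: its marginals are `μ` and `μ'`. -/
structure IsCoupling {d : ℕ} (μ μ' : Measure (Euc d)) (π : Measure (Euc d × Euc d)) : Prop where
  fst_eq : π.map Prod.fst = μ
  snd_eq : π.map Prod.snd = μ'

/-- The Wasserstein-2 distance for the distance function `(y, y') ↦ nrm (y - y')`:
the infimum over all couplings `π` of `(E_π [nrm (y - y')²])^(1/2)`. The infimum is formed in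
`[0, ∞]`; it is finite for probability measures under which `nrm` is bounded. -/
def wasserstein2 {d : ℕ} (nrm : Euc d → ℝ) (μ μ' : Measure (Euc d)) : ℝ :=
  (⨅ (π : Measure (Euc d × Euc d)) (_ : IsCoupling μ μ' π),
    (∫⁻ z, ENNReal.ofReal (nrm (z.1 - z.2) ^ 2) ∂π) ^ (1 / 2 : ℝ)).toReal

/-- The usual Wasserstein-2 distance, for the Euclidean norm. -/
def W2 {d : ℕ} (μ μ' : Measure (Euc d)) : ℝ := wasserstein2 (fun y => ‖y‖) μ μ'

/-- The generalized Wasserstein-2 distance, for the generalized norm. -/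
def genW2 {d : ℕ} (d₁ : ℕ) (lam : ℝ) (μ μ' : Measure (Euc d)) : ℝ :=
  wasserstein2 (genNorm d₁ lam) μ μ'

/-- `max (‖y‖, ‖y‖₂) ≤ √M` holds almost surely under `μ`. -/
def BoundedLaw {d : ℕ} (d₁ : ℕ) (lam M : ℝ) (μ : Measure (Euc d)) : Prop :=
  ∀ᵐ y ∂μ, max (genNorm d₁ lam y) ‖y‖ ≤ Real.sqrt M

/-- `K` is a positive constant with `Ŵ₂ ≤ K W₂`, for all probability measures on `ℝᵈ` that
satisfy the uniform bound with constant `M`. -/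
def IsComparisonConst (d d₁ : ℕ) (lam M K : ℝ) : Prop :=
  0 < K ∧ ∀ μ μ' : Measure (Euc d), IsProbabilityMeasure μ → IsProbabilityMeasure μ' →
    BoundedLaw d₁ lam M μ → BoundedLaw d₁ lam M μ' →
    genW2 d₁ lam μ μ' ≤ K * W2 μ μ'

/-- The law `f_x` of the random field `y_x = y(x; ω)` at the input `x`. -/
def lawAt {n d : ℕ} {Ω : Type*} [MeasurableSpace Ω] (P : Measure Ω) (y : Euc n → Ω → Euc d)
    (x : Euc n) : Measure (Euc d) :=
  P.map (y x)

/-- The squared generalized `W₂` distance between two random fields with laws `f_x`, `f̂_x`: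
`∫_D Ŵ₂²(f_x, f̂_x) ν(dx)`. -/
def fieldW2Sq {n d : ℕ} (d₁ : ℕ) (lam : ℝ) (D : Set (Euc n)) (ν : Measure (Euc n))
    (f f' : Euc n → Measure (Euc d)) : ℝ :=
  ∫ x in D, genW2 d₁ lam (f x) (f' x) ^ 2 ∂ν

/-- The indices of the sample inputs within (Euclidean) distance `δ` of `x`. -/
def nbhd {n N : ℕ} (xs : Fin N → Euc n) (δ : ℝ) (x : Euc n) : Finset (Fin N) :=
  {j | ‖xs j - x‖ ≤ δ}

/-- `N(x, δ)`: the number of sample inputs within distance `δ` of `x`. -/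
def nbhdCount {n N : ℕ} (xs : Fin N → Euc n) (δ : ℝ) (x : Euc n) : ℕ := (nbhd xs δ x).card

/-- The empirical distribution `νᵉ` of the sample inputs. -/
def empInput {n N : ℕ} (xs : Fin N → Euc n) : Measure (Euc n) :=
  (N : ENNReal)⁻¹ • ∑ i : Fin N, Measure.dirac (xs i)

/-- The local empirical measure `fᵉ_{x,δ}`: the empirical distribution of those outputs `ys j`
whose input `xs j` is within distance `δ` of `x`. -/
def localEmp {n d N : ℕ} (xs : Fin N → Euc n) (ys : Fin N → Euc d) (δ : ℝ) (x : Euc n) :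
    Measure (Euc d) :=
  (nbhdCount xs δ x : ENNReal)⁻¹ • ∑ j ∈ nbhd xs δ x, Measure.dirac (ys j)

/-- The generalized local squared `W₂` loss: `∫_D Ŵ₂²(fᵉ_{x,δ}, f̂ᵉ_{x,δ}) νᵉ(dx)`. -/
def localLoss {n d N : ℕ} (d₁ : ℕ) (lam : ℝ) (D : Set (Euc n)) (δ : ℝ)
    (xs : Fin N → Euc n) (ys ys' : Fin N → Euc d) : ℝ :=
  ∫ x in D, genW2 d₁ lam (localEmp xs ys δ x) (localEmp xs ys' δ x) ^ 2 ∂(empInput xs)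

/-- The rate function `h(N, d)`. -/
def rate (N d : ℕ) : ℝ :=
  if d ≤ 4 then 2 * (N : ℝ) ^ (-(1 / 4) : ℝ) * Real.log (1 + N) ^ (1 / 2 : ℝ)
  else 2 * (N : ℝ) ^ (-(1 / d) : ℝ)

/-- The average of `h(N(x, δ), d)` over the empirical distribution of the inputs. -/
def avgRate {n N : ℕ} (d : ℕ) (D : Set (Euc n)) (δ : ℝ) (xs : Fin N → Euc n) : ℝ :=
  ∫ x in D, rate (nbhdCount xs δ x) d ∂(empInput xs)

end

open scoped ENNReal

noncomputable section

/-! ### The generalized norm -/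

/-! The error splits at the average of `Ŵ₂²(f_x, f̂_x)` over the sample inputs. The distance from
the true integral to this average is the mean deviation of independent variables bounded by `4M`, so
a variance bound gives `4M/√N` (`integral_abs_fieldW2Sq_sub_average_le`).

For the rest, both distances are at most `2√M`, so a difference of squares costs a factor `4√M`. The
generalized norm satisfies the triangle inequality, hence so does `Ŵ₂` by gluing couplings. It
remains to bound the distance from `f_x` to its local empirical measure, and likewise for `f̂_x`.
The intermediate measure is the average of the laws `f_{x_j}` over the neighbours: it is within `Lδ`
of `f_x` because Wasserstein distances are quasi-convex, and its distance to the empirical measure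
is at most `K` times a Euclidean `W₂` (`genW2_lawAt_localEmp_le`).

Conditionally on the inputs, that last term compares an empirical measure of `m` independent points,
not identically distributed, with the average of their laws. A coupling that matches mass inside the
finest dyadic cells first, and passes the remainder to coarser cells, bounds `W₂²` by the weighted
discrepancies of cell masses (`exists_coupling_of_nested`, `W2_sq_le_dyadic`). The mean discrepancy
over the `2^(jd)` cells of level `j` is at most `√(2^(jd)/m)`; with a suitable number of scales the
weighted sum is of order `h(m,d)²` (`exists_dyadic_sum_le_rate_sq`).

The passage from `W₂²` to `W₂` uses `w ≤ (a + w²/a)/2` with `a` a multiple of the rate. The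
resulting majorant `sampleBound` is visibly measurable in the sample, so joint measurability of `W₂`
itself is never required. -/

/-- The coordinatewise absolute values whose Euclidean norm is `genNorm`. -/
def genNormCoord {d : ℕ} (d₁ : ℕ) (lam : ℝ) (y : Euc d) (i : Fin d) : ℝ :=
  if (i : ℕ) < d₁ then √lam * |y i| else min (2 * |y i|) 1

/-- The categorical term is the square of a truncated absolute value. Truncation preserves
subadditivity, and this is what makes `genNorm` obey the triangle inequality although it is not
homogeneous. -/
lemma deltaHat_eq (t : ℝ) : deltaHat t = min (2 * |t|) 1 ^ 2 := by
  unfold deltaHat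
  split_ifs with h
  · rw [min_eq_left (by linarith), mul_pow, sq_abs]; norm_num
  · rw [min_eq_right (by linarith)]; norm_num

lemma genNorm_eq_sqrt_sum {d : ℕ} (d₁ : ℕ) {lam : ℝ} (hlam : 0 ≤ lam) (y : Euc d) :
    genNorm d₁ lam y = √(∑ i, genNormCoord d₁ lam y i ^ 2) := by
  unfold genNorm genNormCoord
  congr 1
  refine Finset.sum_congr rfl fun i _ => ?_
  split_ifs with h
  · rw [mul_pow, Real.sq_sqrt hlam, sq_abs]
  · exact deltaHat_eq _

lemma genNorm_eq_norm {d : ℕ} (d₁ : ℕ) {lam : ℝ} (hlam : 0 ≤ lam) (y : Euc d) :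
    genNorm d₁ lam y = ‖(WithLp.toLp 2 (genNormCoord d₁ lam y) : Euc d)‖ := by
  rw [genNorm_eq_sqrt_sum d₁ hlam, EuclideanSpace.norm_eq]
  simp

lemma genNormCoord_nonneg {d : ℕ} (d₁ : ℕ) (lam : ℝ) (y : Euc d) (i : Fin d) :
    0 ≤ genNormCoord d₁ lam y i := by
  unfold genNormCoord
  split_ifs <;> positivity

lemma genNormCoord_add_le {d : ℕ} (d₁ : ℕ) (lam : ℝ) (x y : Euc d) (i : Fin d) :
    genNormCoord d₁ lam (x + y) i ≤ genNormCoord d₁ lam x i + genNormCoord d₁ lam y i := by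
  unfold genNormCoord
  have h := abs_add_le (x i) (y i)
  split_ifs
  · rw [← mul_add]
    exact mul_le_mul_of_nonneg_left h (Real.sqrt_nonneg _)
  · have hx := abs_nonneg (x i)
    have hy := abs_nonneg (y i)
    simp only [PiLp.add_apply]
    rcases min_cases (2 * |x i|) 1 with h1 | h1 <;> rcases min_cases (2 * |y i|) 1 with h2 | h2 <;>
      rcases min_cases (2 * |x i + y i|) 1 with h3 | h3 <;> linarith

lemma genNorm_nonneg {d : ℕ} (d₁ : ℕ) (lam : ℝ) (y : Euc d) : 0 ≤ genNorm d₁ lam y :=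
  Real.sqrt_nonneg _

/-- Each nonnegative coordinate is subadditive and the Euclidean norm is monotone on nonnegative
vectors, so Minkowski's inequality finishes. -/
lemma genNorm_add_le {d : ℕ} (d₁ : ℕ) {lam : ℝ} (hlam : 0 ≤ lam) (x y : Euc d) :
    genNorm d₁ lam (x + y) ≤ genNorm d₁ lam x + genNorm d₁ lam y := by
  calc genNorm d₁ lam (x + y)
      ≤ ‖(WithLp.toLp 2 (genNormCoord d₁ lam x) : Euc d) +
          WithLp.toLp 2 (genNormCoord d₁ lam y)‖ := by
        rw [genNorm_eq_sqrt_sum d₁ hlam, EuclideanSpace.norm_eq]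
        refine Real.sqrt_le_sqrt (Finset.sum_le_sum fun i _ => ?_)
        rw [Real.norm_eq_abs, sq_abs]
        exact pow_le_pow_left₀ (genNormCoord_nonneg _ _ _ _) (genNormCoord_add_le _ _ _ _ _) 2
    _ ≤ _ := by
        rw [genNorm_eq_norm d₁ hlam x, genNorm_eq_norm d₁ hlam y]
        exact norm_add_le _ _

lemma genNorm_neg {d : ℕ} (d₁ : ℕ) (lam : ℝ) (y : Euc d) :
    genNorm d₁ lam (-y) = genNorm d₁ lam y := by
  simp [genNorm, deltaHat]

lemma genNorm_le {d : ℕ} (d₁ : ℕ) (lam : ℝ) (y : Euc d) :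
    genNorm d₁ lam y ≤ √(max lam 4) * ‖y‖ := by
  rw [EuclideanSpace.norm_eq, ← Real.sqrt_mul (by positivity)]
  refine Real.sqrt_le_sqrt ?_
  rw [Finset.mul_sum]
  refine Finset.sum_le_sum fun i _ => ?_
  rw [Real.norm_eq_abs, sq_abs]
  have hs := sq_nonneg (y i)
  split_ifs
  · exact mul_le_mul_of_nonneg_right (le_max_left _ _) hs
  · refine le_trans ?_ (mul_le_mul_of_nonneg_right (le_max_right lam 4) hs)
    rw [deltaHat_eq]
    calc min (2 * |y i|) 1 ^ 2 ≤ (2 * |y i|) ^ 2 :=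
          pow_le_pow_left₀ (by positivity) (min_le_left _ _) 2
      _ = 4 * y i ^ 2 := by rw [mul_pow, sq_abs]; norm_num

lemma measurable_genNorm {d : ℕ} (d₁ : ℕ) (lam : ℝ) :
    Measurable (genNorm d₁ lam : Euc d → ℝ) := by
  unfold genNorm
  refine Measurable.sqrt (Finset.measurable_sum _ fun i _ => ?_)
  split_ifs
  · fun_prop
  · simp only [deltaHat_eq]
    fun_prop

/-! ### The Wasserstein distance as an extended real -/

/-- The infimum defining `wasserstein2`, as an extended nonnegative real. -/
def ewasserstein2 {d : ℕ} (nrm : Euc d → ℝ) (μ μ' : Measure (Euc d)) : ℝ≥0∞ :=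
  ⨅ (π : Measure (Euc d × Euc d)) (_ : IsCoupling μ μ' π),
    (∫⁻ z, ENNReal.ofReal (nrm (z.1 - z.2) ^ 2) ∂π) ^ (1 / 2 : ℝ)

lemma wasserstein2_eq_toReal {d : ℕ} (nrm : Euc d → ℝ) (μ μ' : Measure (Euc d)) :
    wasserstein2 nrm μ μ' = (ewasserstein2 nrm μ μ').toReal := rfl

lemma ewasserstein2_le_of_isCoupling {d : ℕ} (nrm : Euc d → ℝ) {μ μ' : Measure (Euc d)}
    {π : Measure (Euc d × Euc d)} (h : IsCoupling μ μ' π) :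
    ewasserstein2 nrm μ μ' ≤ (∫⁻ z, ENNReal.ofReal (nrm (z.1 - z.2) ^ 2) ∂π) ^ (1 / 2 : ℝ) :=
  iInf₂_le π h

lemma exists_isCoupling_lt {d : ℕ} (nrm : Euc d → ℝ) {μ μ' : Measure (Euc d)} {r : ℝ≥0∞}
    (h : ewasserstein2 nrm μ μ' < r) :
    ∃ π, IsCoupling μ μ' π ∧
      (∫⁻ z, ENNReal.ofReal (nrm (z.1 - z.2) ^ 2) ∂π) ^ (1 / 2 : ℝ) < r := by
  unfold ewasserstein2 at h
  simpa only [iInf_lt_iff, exists_prop] using h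

lemma IsCoupling.isProbabilityMeasure {d : ℕ} {μ μ' : Measure (Euc d)}
    {π : Measure (Euc d × Euc d)} (h : IsCoupling μ μ' π) [IsProbabilityMeasure μ] :
    IsProbabilityMeasure π := by
  constructor
  have := congrArg (fun m => m Set.univ) h.fst_eq
  simpa [Measure.map_apply measurable_fst MeasurableSet.univ] using this

lemma IsCoupling.swap {d : ℕ} {μ μ' : Measure (Euc d)} {π : Measure (Euc d × Euc d)}
    (h : IsCoupling μ μ' π) : IsCoupling μ' μ (π.map Prod.swap) := by
  constructor
  · rw [Measure.map_map measurable_fst measurable_swap]; exact h.snd_eq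
  · rw [Measure.map_map measurable_snd measurable_swap]; exact h.fst_eq

lemma isCoupling_prod {d : ℕ} (μ μ' : Measure (Euc d)) [IsProbabilityMeasure μ]
    [IsProbabilityMeasure μ'] : IsCoupling μ μ' (μ.prod μ') :=
  ⟨by simp [Measure.map_fst_prod], by simp [Measure.map_snd_prod]⟩

lemma ewasserstein2_symm_le {d : ℕ} {nrm : Euc d → ℝ} (hm : Measurable nrm)
    (hneg : ∀ y, nrm (-y) = nrm y) (μ μ' : Measure (Euc d)) :
    ewasserstein2 nrm μ' μ ≤ ewasserstein2 nrm μ μ' := by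
  refine le_iInf₂ fun π hπ => ?_
  refine (ewasserstein2_le_of_isCoupling nrm hπ.swap).trans (le_of_eq ?_)
  rw [lintegral_map (by fun_prop) measurable_swap]
  congr 2
  ext z
  rw [Prod.fst_swap, Prod.snd_swap, ← hneg, neg_sub]

lemma ewasserstein2_comm {d : ℕ} {nrm : Euc d → ℝ} (hm : Measurable nrm)
    (hneg : ∀ y, nrm (-y) = nrm y) (μ μ' : Measure (Euc d)) :
    ewasserstein2 nrm μ μ' = ewasserstein2 nrm μ' μ :=
  le_antisymm (ewasserstein2_symm_le hm hneg _ _) (ewasserstein2_symm_le hm hneg _ _)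

/-- Gluing of two couplings along their common marginal. -/
lemma exists_gluing {d : ℕ} {μ ν ρ : Measure (Euc d)} [IsProbabilityMeasure μ]
    [IsProbabilityMeasure ν] {π₁ π₂ : Measure (Euc d × Euc d)} (h₁ : IsCoupling μ ν π₁)
    (h₂ : IsCoupling ν ρ π₂) :
    ∃ Γ : Measure ((Euc d × Euc d) × Euc d), Γ.map Prod.fst = π₁ ∧
      Γ.map (fun z => (z.1.2, z.2)) = π₂ := by
  have := h₁.isProbabilityMeasure
  have := h₂.isProbabilityMeasure
  -- Draw a pair from `π₁`, then the third point from the conditional law of `π₂` given that its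
  -- first coordinate is the second point of the pair.
  refine ⟨π₁ ⊗ₘ (π₂.condKernel.comap Prod.snd measurable_snd), Measure.fst_compProd _ _, ?_⟩
  ext s hs
  rw [Measure.map_apply (by fun_prop) hs, Measure.compProd_apply (by measurability)]
  conv_rhs => rw [← Measure.disintegrate π₂ π₂.condKernel, Measure.compProd_apply hs]
  have : π₂.fst = π₁.map Prod.snd := h₂.fst_eq.trans h₁.snd_eq.symm
  rw [this, lintegral_map (Kernel.measurable_kernel_prodMk_left hs) measurable_snd]
  rfl

lemma ofReal_sq_eq_rpow {t : ℝ} (ht : 0 ≤ t) :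
    ENNReal.ofReal (t ^ 2) = ENNReal.ofReal t ^ (2 : ℝ) := by
  rw [ENNReal.ofReal_rpow_of_nonneg ht (by norm_num)]
  norm_num

/-- Glue the two couplings along `ν` and apply Minkowski in `L²(Γ)`. Working in `[0, ∞]` with
arbitrary couplings avoids both attainment of the infimum and finiteness. -/
lemma ewasserstein2_triangle {d : ℕ} {nrm : Euc d → ℝ} (hm : Measurable nrm)
    (h0 : ∀ y, 0 ≤ nrm y) (hadd : ∀ x y, nrm (x + y) ≤ nrm x + nrm y)
    (μ ν ρ : Measure (Euc d)) [IsProbabilityMeasure μ] [IsProbabilityMeasure ν] :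
    ewasserstein2 nrm μ ρ ≤ ewasserstein2 nrm μ ν + ewasserstein2 nrm ν ρ := by
  conv_rhs => unfold ewasserstein2
  simp only [ENNReal.iInf_add, ENNReal.add_iInf]
  refine le_iInf₂ fun π₂ h₂ => le_iInf₂ fun π₁ h₁ => ?_
  obtain ⟨Γ, hΓ₁, hΓ₂⟩ := exists_gluing h₁ h₂
  have hc : IsCoupling μ ρ (Γ.map fun z => (z.1.1, z.2)) := by
    constructor
    · rw [← h₁.fst_eq, ← hΓ₁, Measure.map_map measurable_fst (by fun_prop),
        Measure.map_map measurable_fst measurable_fst]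
      rfl
    · rw [← h₂.snd_eq, ← hΓ₂, Measure.map_map measurable_snd (by fun_prop),
        Measure.map_map measurable_snd (by fun_prop)]
      rfl
  refine (ewasserstein2_le_of_isCoupling nrm hc).trans ?_
  rw [← hΓ₁, ← hΓ₂, lintegral_map (by fun_prop) (by fun_prop),
    lintegral_map (by fun_prop) (by fun_prop), lintegral_map (by fun_prop) (by fun_prop)]
  simp only [ofReal_sq_eq_rpow (h0 _)]
  refine le_trans ?_ (ENNReal.lintegral_Lp_add_le (μ := Γ) (p := 2)
    (f := fun z => ENNReal.ofReal (nrm (z.1.1 - z.1.2)))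
    (g := fun z => ENNReal.ofReal (nrm (z.1.2 - z.2))) (by fun_prop) (by fun_prop) (by norm_num))
  refine ENNReal.rpow_le_rpow (lintegral_mono fun z => ?_) (by norm_num)
  refine ENNReal.rpow_le_rpow ?_ (by norm_num)
  rw [Pi.add_apply, ← ENNReal.ofReal_add (h0 _) (h0 _)]
  refine ENNReal.ofReal_le_ofReal ?_
  rw [← sub_add_sub_cancel z.1.1 z.1.2 z.2]
  exact hadd _ _

/-! ### Uniform averages of measures -/

/-- The uniform average of a finite family of measures. -/
def avgMeasure {ι α : Type*} [MeasurableSpace α] (J : Finset ι) (μ : ι → Measure α) : Measure α :=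
  (J.card : ℝ≥0∞)⁻¹ • ∑ j ∈ J, μ j

lemma localEmp_eq_avgMeasure {n d N : ℕ} (xs : Fin N → Euc n) (ys : Fin N → Euc d) (δ : ℝ)
    (x : Euc n) :
    localEmp xs ys δ x = avgMeasure (nbhd xs δ x) (fun j => Measure.dirac (ys j)) := rfl

lemma card_inv_mul_sum_const {ι : Type*} {J : Finset ι} (hJ : J.Nonempty) (r : ℝ≥0∞) :
    (J.card : ℝ≥0∞)⁻¹ * ∑ _j ∈ J, r = r := by
  rw [Finset.sum_const, nsmul_eq_mul, ← mul_assoc, ENNReal.inv_mul_cancel _ (by simp), one_mul]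
  simpa using hJ.ne_empty

lemma isProbabilityMeasure_avgMeasure {ι α : Type*} [MeasurableSpace α] {J : Finset ι}
    (hJ : J.Nonempty) (μ : ι → Measure α) (hμ : ∀ j ∈ J, IsProbabilityMeasure (μ j)) :
    IsProbabilityMeasure (avgMeasure J μ) := by
  constructor
  rw [avgMeasure, Measure.smul_apply, Measure.finsetSum_apply, smul_eq_mul,
    Finset.sum_congr rfl fun j hj => (hμ j hj).measure_univ]
  exact card_inv_mul_sum_const hJ 1

lemma avgMeasure_const {ι α : Type*} [MeasurableSpace α] {J : Finset ι} (hJ : J.Nonempty)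
    (μ : Measure α) : avgMeasure J (fun _ => μ) = μ := by
  ext s _
  rw [avgMeasure, Measure.smul_apply, Measure.finsetSum_apply, smul_eq_mul]
  exact card_inv_mul_sum_const hJ _

lemma map_avgMeasure {ι α β : Type*} [MeasurableSpace α] [MeasurableSpace β] {f : α → β}
    (hf : Measurable f) (J : Finset ι) (μ : ι → Measure α) :
    (avgMeasure J μ).map f = avgMeasure J (fun j => (μ j).map f) := by
  ext s hs
  simp [avgMeasure, Measure.map_apply hf hs]

lemma avgMeasure_congr {ι α : Type*} [MeasurableSpace α] {J : Finset ι} {μ μ' : ι → Measure α}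
    (h : ∀ j ∈ J, μ j = μ' j) : avgMeasure J μ = avgMeasure J μ' := by
  rw [avgMeasure, avgMeasure, Finset.sum_congr rfl h]

lemma lintegral_avgMeasure {ι α : Type*} [MeasurableSpace α] (J : Finset ι) (μ : ι → Measure α)
    (f : α → ℝ≥0∞) :
    ∫⁻ a, f a ∂(avgMeasure J μ) = (J.card : ℝ≥0∞)⁻¹ * ∑ j ∈ J, ∫⁻ a, f a ∂(μ j) := by
  rw [avgMeasure, lintegral_smul_measure, lintegral_finsetSum_measure, smul_eq_mul]

lemma ae_avgMeasure {ι α : Type*} [MeasurableSpace α] {J : Finset ι} {μ : ι → Measure α}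
    {p : α → Prop} (h : ∀ j ∈ J, ∀ᵐ a ∂(μ j), p a) : ∀ᵐ a ∂(avgMeasure J μ), p a := by
  rw [ae_iff, avgMeasure, Measure.smul_apply, Measure.finsetSum_apply,
    Finset.sum_eq_zero fun j hj => ae_iff.1 (h j hj), smul_zero]

/-- The Wasserstein distance is quasi-convex under uniform averages. -/
lemma ewasserstein2_avgMeasure_le {d : ℕ} {ι : Type*} {nrm : Euc d → ℝ} {J : Finset ι}
    (hJ : J.Nonempty) (μ ν : ι → Measure (Euc d)) {r : ℝ≥0∞}
    (h : ∀ j ∈ J, ewasserstein2 nrm (μ j) (ν j) ≤ r) :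
    ewasserstein2 nrm (avgMeasure J μ) (avgMeasure J ν) ≤ r := by
  refine le_of_forall_gt fun s hs => ?_
  -- Optimal couplings are not known to exist, so slack above `r` is needed to pick near-optimal
  -- ones; averaging them couples the averages.
  obtain ⟨t, hrt, hts⟩ := exists_between hs
  refine lt_of_le_of_lt ?_ hts
  have hex : ∀ j, ∃ π, j ∈ J → IsCoupling (μ j) (ν j) π ∧
      (∫⁻ z, ENNReal.ofReal (nrm (z.1 - z.2) ^ 2) ∂π) ^ (1 / 2 : ℝ) < t := by
    intro j
    by_cases hj : j ∈ J
    · obtain ⟨π, hπ⟩ := exists_isCoupling_lt nrm ((h j hj).trans_lt hrt)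
      exact ⟨π, fun _ => hπ⟩
    · exact ⟨0, fun hj' => absurd hj' hj⟩
  choose π hπ using hex
  have hc : IsCoupling (avgMeasure J μ) (avgMeasure J ν) (avgMeasure J π) := by
    constructor
    · rw [map_avgMeasure measurable_fst]
      exact avgMeasure_congr fun j hj => (hπ j hj).1.fst_eq
    · rw [map_avgMeasure measurable_snd]
      exact avgMeasure_congr fun j hj => (hπ j hj).1.snd_eq
  refine (ewasserstein2_le_of_isCoupling nrm hc).trans ?_
  rw [one_div, ENNReal.rpow_inv_le_iff (by norm_num), lintegral_avgMeasure]
  calc _ ≤ (J.card : ℝ≥0∞)⁻¹ * ∑ j ∈ J, t ^ (2 : ℝ) := by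
        gcongr with j hj
        have := (hπ j hj).2.le
        rwa [one_div, ENNReal.rpow_inv_le_iff (by norm_num)] at this
    _ = _ := card_inv_mul_sum_const hJ _

lemma isCoupling_dirac {d : ℕ} (a b : Euc d) :
    IsCoupling (Measure.dirac a) (Measure.dirac b) (Measure.dirac (a, b)) :=
  ⟨Measure.map_dirac' measurable_fst _, Measure.map_dirac' measurable_snd _⟩

lemma ewasserstein2_dirac_le {d : ℕ} {nrm : Euc d → ℝ} (h0 : ∀ y, 0 ≤ nrm y)
    (a b : Euc d) :
    ewasserstein2 nrm (Measure.dirac a) (Measure.dirac b) ≤ ENNReal.ofReal (nrm (a - b)) := by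
  refine (ewasserstein2_le_of_isCoupling nrm (isCoupling_dirac a b)).trans ?_
  rw [lintegral_dirac, ofReal_sq_eq_rpow (h0 _), ← ENNReal.rpow_mul]
  norm_num

/-- Under an almost sure bound on the norm, the Wasserstein distance is bounded. -/
lemma ewasserstein2_le_of_ae_le {d : ℕ} {nrm : Euc d → ℝ}
    (h0 : ∀ y, 0 ≤ nrm y) (hneg : ∀ y, nrm (-y) = nrm y)
    (hadd : ∀ x y, nrm (x + y) ≤ nrm x + nrm y) {R : ℝ}
    {μ μ' : Measure (Euc d)} [IsProbabilityMeasure μ] [IsProbabilityMeasure μ']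
    (h : ∀ᵐ y ∂μ, nrm y ≤ R) (h' : ∀ᵐ y ∂μ', nrm y ≤ R) :
    ewasserstein2 nrm μ μ' ≤ ENNReal.ofReal (2 * R) := by
  have hc := isCoupling_prod μ μ'
  refine (ewasserstein2_le_of_isCoupling nrm hc).trans ?_
  rw [one_div, ENNReal.rpow_inv_le_iff (by norm_num)]
  have h1 : ∀ᵐ z ∂(μ.prod μ'), nrm z.1 ≤ R :=
    ae_of_ae_map measurable_fst.aemeasurable (by rwa [hc.fst_eq])
  have h2 : ∀ᵐ z ∂(μ.prod μ'), nrm z.2 ≤ R :=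
    ae_of_ae_map measurable_snd.aemeasurable (by rwa [hc.snd_eq])
  calc ∫⁻ z, ENNReal.ofReal (nrm (z.1 - z.2) ^ 2) ∂(μ.prod μ')
      ≤ ∫⁻ _, ENNReal.ofReal (2 * R) ^ (2 : ℝ) ∂(μ.prod μ') := by
        refine lintegral_mono_ae ?_
        filter_upwards [h1, h2] with z hz1 hz2
        rw [ofReal_sq_eq_rpow (h0 _)]
        refine ENNReal.rpow_le_rpow (ENNReal.ofReal_le_ofReal ?_) (by norm_num)
        rw [sub_eq_add_neg]
        have := hadd z.1 (-z.2)
        rw [hneg] at this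
        linarith
    _ = _ := by simp

lemma ewasserstein2_le_mul {d : ℕ} {nrm nrm' : Euc d → ℝ} {K : ℝ} (hK : 0 < K)
    (h0 : ∀ y, 0 ≤ nrm y) (hm : Measurable nrm')
    (h : ∀ y, nrm y ≤ K * nrm' y) (μ μ' : Measure (Euc d)) :
    ewasserstein2 nrm μ μ' ≤ ENNReal.ofReal K * ewasserstein2 nrm' μ μ' := by
  conv_rhs => unfold ewasserstein2
  rw [ENNReal.mul_iInf_of_ne (by simpa using hK) (by simp)]
  refine le_iInf fun π => ?_
  rw [ENNReal.mul_iInf_of_ne (by simpa using hK) (by simp)]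
  refine le_iInf fun hπ => ?_
  refine (ewasserstein2_le_of_isCoupling nrm hπ).trans ?_
  have hK2 : ENNReal.ofReal K = (ENNReal.ofReal (K ^ 2)) ^ (1 / 2 : ℝ) := by
    rw [ofReal_sq_eq_rpow hK.le, ← ENNReal.rpow_mul]; norm_num
  rw [hK2, ← ENNReal.mul_rpow_of_nonneg _ _ (by norm_num), ← lintegral_const_mul _ (by fun_prop)]
  refine ENNReal.rpow_le_rpow (lintegral_mono fun z => ?_) (by norm_num)
  rw [← ENNReal.ofReal_mul (by positivity), ← mul_pow]
  exact ENNReal.ofReal_le_ofReal (pow_le_pow_left₀ (h0 _) (h _) 2)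

/-! ### The generalized Wasserstein distance -/

section genW2

variable {d : ℕ} {d₁ : ℕ} {lam M : ℝ}

lemma BoundedLaw.genNorm_le {μ : Measure (Euc d)} (h : BoundedLaw d₁ lam M μ) :
    ∀ᵐ y ∂μ, genNorm d₁ lam y ≤ √M :=
  h.mono fun _ hy => (le_max_left _ _).trans hy

lemma BoundedLaw.norm_le {μ : Measure (Euc d)} (h : BoundedLaw d₁ lam M μ) :
    ∀ᵐ y ∂μ, ‖y‖ ≤ √M :=
  h.mono fun _ hy => (le_max_right _ _).trans hy

lemma ewasserstein2_genNorm_le (hlam : 0 ≤ lam) {μ μ' : Measure (Euc d)} [IsProbabilityMeasure μ]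
    [IsProbabilityMeasure μ'] (h : BoundedLaw d₁ lam M μ) (h' : BoundedLaw d₁ lam M μ') :
    ewasserstein2 (genNorm d₁ lam) μ μ' ≤ ENNReal.ofReal (2 * √M) :=
  ewasserstein2_le_of_ae_le (genNorm_nonneg _ _) (genNorm_neg _ _) (genNorm_add_le _ hlam)
    h.genNorm_le h'.genNorm_le

lemma ewasserstein2_norm_le {μ μ' : Measure (Euc d)} [IsProbabilityMeasure μ]
    [IsProbabilityMeasure μ'] (h : BoundedLaw d₁ lam M μ) (h' : BoundedLaw d₁ lam M μ') :
    ewasserstein2 (fun y => ‖y‖) μ μ' ≤ ENNReal.ofReal (2 * √M) :=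
  ewasserstein2_le_of_ae_le (fun _ => norm_nonneg _) norm_neg norm_add_le h.norm_le h'.norm_le

lemma ewasserstein2_genNorm_ne_top (hlam : 0 ≤ lam) {μ μ' : Measure (Euc d)}
    [IsProbabilityMeasure μ]
    [IsProbabilityMeasure μ'] (h : BoundedLaw d₁ lam M μ) (h' : BoundedLaw d₁ lam M μ') :
    ewasserstein2 (genNorm d₁ lam) μ μ' ≠ ∞ :=
  ((ewasserstein2_genNorm_le hlam h h').trans_lt ENNReal.ofReal_lt_top).ne

lemma genW2_nonneg (μ μ' : Measure (Euc d)) : 0 ≤ genW2 d₁ lam μ μ' := ENNReal.toReal_nonneg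

lemma genW2_le (hlam : 0 ≤ lam) {μ μ' : Measure (Euc d)} [IsProbabilityMeasure μ]
    [IsProbabilityMeasure μ'] (h : BoundedLaw d₁ lam M μ) (h' : BoundedLaw d₁ lam M μ') :
    genW2 d₁ lam μ μ' ≤ 2 * √M :=
  ENNReal.toReal_le_of_le_ofReal (by positivity) (ewasserstein2_genNorm_le hlam h h')

lemma genW2_comm (μ μ' : Measure (Euc d)) : genW2 d₁ lam μ μ' = genW2 d₁ lam μ' μ := by
  unfold genW2
  rw [wasserstein2_eq_toReal, wasserstein2_eq_toReal,
    ewasserstein2_comm (measurable_genNorm _ _) (genNorm_neg _ _)]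

/-- Boundedness is needed here for finiteness: `toReal` sends `∞` to `0`, which could falsify the
inequality if a distance on the right were infinite. -/
lemma genW2_triangle (hlam : 0 ≤ lam) {μ ν ρ : Measure (Euc d)} [IsProbabilityMeasure μ]
    [IsProbabilityMeasure ν] [IsProbabilityMeasure ρ] (hμ : BoundedLaw d₁ lam M μ)
    (hν : BoundedLaw d₁ lam M ν) (hρ : BoundedLaw d₁ lam M ρ) :
    genW2 d₁ lam μ ρ ≤ genW2 d₁ lam μ ν + genW2 d₁ lam ν ρ := by
  have h1 := ewasserstein2_genNorm_ne_top hlam hμ hν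
  have h2 := ewasserstein2_genNorm_ne_top hlam hν hρ
  unfold genW2
  simp only [wasserstein2_eq_toReal]
  rw [← ENNReal.toReal_add h1 h2]
  exact ENNReal.toReal_mono (ENNReal.add_ne_top.2 ⟨h1, h2⟩)
    (ewasserstein2_triangle (measurable_genNorm _ _) (genNorm_nonneg _ _) (genNorm_add_le _ hlam)
      μ ν ρ)

lemma abs_genW2_sub_le (hlam : 0 ≤ lam) {μ μ' ν ν' : Measure (Euc d)} [IsProbabilityMeasure μ]
    [IsProbabilityMeasure ν] [IsProbabilityMeasure μ'] [IsProbabilityMeasure ν']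
    (hμ : BoundedLaw d₁ lam M μ) (hν : BoundedLaw d₁ lam M ν)
    (hμ' : BoundedLaw d₁ lam M μ') (hν' : BoundedLaw d₁ lam M ν') :
    |genW2 d₁ lam μ μ' - genW2 d₁ lam ν ν'| ≤ genW2 d₁ lam μ ν + genW2 d₁ lam μ' ν' := by
  have h1 := genW2_triangle hlam hμ hν hμ'
  have h2 := genW2_triangle hlam hν hν' hμ'
  have h3 := genW2_triangle hlam hν hμ hν'
  have h4 := genW2_triangle hlam hμ hμ' hν'
  rw [genW2_comm ν' μ'] at h2
  rw [genW2_comm ν μ] at h3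
  rw [abs_le]
  constructor <;> linarith

lemma genW2_avgMeasure_le (hlam : 0 ≤ lam) {ι : Type*} {J : Finset ι} (hJ : J.Nonempty)
    {μ : Measure (Euc d)} {ν : ι → Measure (Euc d)} [IsProbabilityMeasure μ]
    (hν : ∀ j ∈ J, IsProbabilityMeasure (ν j)) (hμb : BoundedLaw d₁ lam M μ)
    (hνb : ∀ j ∈ J, BoundedLaw d₁ lam M (ν j)) {r : ℝ} (hr : 0 ≤ r)
    (h : ∀ j ∈ J, genW2 d₁ lam μ (ν j) ≤ r) :
    genW2 d₁ lam μ (avgMeasure J ν) ≤ r := by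
  refine ENNReal.toReal_le_of_le_ofReal hr ?_
  change ewasserstein2 (genNorm d₁ lam) μ (avgMeasure J ν) ≤ _
  -- Writing the fixed measure as an average of copies of itself brings quasi-convexity into play.
  rw [← avgMeasure_const hJ μ]
  refine ewasserstein2_avgMeasure_le hJ _ _ fun j hj => ?_
  have := hν j hj
  exact (ENNReal.le_ofReal_iff_toReal_le (ewasserstein2_genNorm_ne_top hlam hμb (hνb j hj)) hr).2
    (h j hj)

/-- The pointwise bound `genNorm_le` holds on the whole space; the bounded support only ensures that
`W₂` is finite, so that real values may be compared. -/
lemma exists_isComparisonConst : ∃ K : ℝ, IsComparisonConst d d₁ lam M K := by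
  refine ⟨√(max lam 4), Real.sqrt_pos.2 (by positivity), fun μ μ' _ _ h h' => ?_⟩
  have hfin : ewasserstein2 (fun y => ‖y‖) μ μ' ≠ ∞ :=
    ((ewasserstein2_norm_le h h').trans_lt ENNReal.ofReal_lt_top).ne
  have := ENNReal.toReal_mono (ENNReal.mul_ne_top ENNReal.ofReal_ne_top hfin)
    (ewasserstein2_le_mul (Real.sqrt_pos.2 (by positivity : (0 : ℝ) < max lam 4)) (genNorm_nonneg d₁ lam)
      measurable_norm (_root_.genNorm_le d₁ lam) μ μ')
  rwa [ENNReal.toReal_mul, ENNReal.toReal_ofReal (Real.sqrt_nonneg _)] at this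

end genW2

/-! ### Couplings adapted to nested partitions -/

section Matching

variable {α ι : Type*} [MeasurableSpace α] [MeasurableSpace ι] [Countable ι]
  [MeasurableSingletonClass ι]

lemma sum_restrict_fibers (μ : Measure α) {q : α → ι} (hq : Measurable q) :
    Measure.sum (fun i => μ.restrict (q ⁻¹' {i})) = μ := by
  rw [← Measure.restrict_iUnion (fun i j hij => Disjoint.preimage _ (by simpa using hij))
    (fun i => hq (measurableSet_singleton i))]
  rw [show (⋃ i, q ⁻¹' {i}) = Set.univ by ext x; simp, Measure.restrict_univ]

/-- Inside every fiber of `q`, couple as much mass of `μ` and `ν` as possible. -/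
lemma exists_matching (μ ν : Measure α) [IsFiniteMeasure μ] [IsFiniteMeasure ν] {q : α → ι}
    (hq : Measurable q) :
    ∃ (μ₁ ν₁ : Measure α) (π : Measure (α × α)), π.map Prod.fst + μ₁ = μ ∧
      π.map Prod.snd + ν₁ = ν ∧ (∀ᵐ z ∂π, q z.1 = q z.2) ∧
      μ₁ Set.univ = ∑' i, (μ (q ⁻¹' {i}) - ν (q ⁻¹' {i})) := by
  have hF : ∀ i, MeasurableSet (q ⁻¹' {i}) := fun i => hq (measurableSet_singleton i)
  -- The common mass of a fiber. The product of the restrictions is scaled to have exactly this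
  -- mass, so its marginals are `m / μ(F)` times `μ` and `m / ν(F)` times `ν` on the fiber; null
  -- fibers get weight `0 / 0 = 0`.
  set m : ι → ℝ≥0∞ := fun i => min (μ (q ⁻¹' {i})) (ν (q ⁻¹' {i})) with hm
  set π : Measure (α × α) := Measure.sum fun i =>
    (m i / (μ (q ⁻¹' {i}) * ν (q ⁻¹' {i}))) •
      (μ.restrict (q ⁻¹' {i})).prod (ν.restrict (q ⁻¹' {i})) with hπ
  have hμm : ∀ i, m i / (μ (q ⁻¹' {i}) * ν (q ⁻¹' {i})) * ν (q ⁻¹' {i}) =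
      m i / μ (q ⁻¹' {i}) := by
    intro i
    by_cases h : ν (q ⁻¹' {i}) = 0
    · simp [hm, h]
    · rw [← ENNReal.mul_div_right_comm, ENNReal.mul_div_mul_right _ _ h (measure_ne_top _ _)]
  have hνm : ∀ i, m i / (μ (q ⁻¹' {i}) * ν (q ⁻¹' {i})) * μ (q ⁻¹' {i}) =
      m i / ν (q ⁻¹' {i}) := by
    intro i
    by_cases h : μ (q ⁻¹' {i}) = 0
    · simp [hm, h]
    · rw [← ENNReal.mul_div_right_comm, mul_comm (m i),
        ENNReal.mul_div_mul_left _ _ h (measure_ne_top _ _)]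
  have hfst : π.map Prod.fst =
      Measure.sum fun i => (m i / μ (q ⁻¹' {i})) • μ.restrict (q ⁻¹' {i}) := by
    rw [hπ, Measure.map_sum measurable_fst.aemeasurable]
    congr 1
    ext1 i
    rw [Measure.map_smul, Measure.map_fst_prod, smul_smul, Measure.restrict_apply_univ, hμm]
  have hsnd : π.map Prod.snd =
      Measure.sum fun i => (m i / ν (q ⁻¹' {i})) • ν.restrict (q ⁻¹' {i}) := by
    rw [hπ, Measure.map_sum measurable_snd.aemeasurable]
    congr 1
    ext1 i
    rw [Measure.map_smul, Measure.map_snd_prod, smul_smul, Measure.restrict_apply_univ, hνm]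
  -- The remainders are what the marginals leave on each fiber. Subtraction in `[0, ∞]` is
  -- truncated, so the remainder of `μ` on a fiber has mass equal to the positive part of the
  -- difference.
  refine ⟨Measure.sum fun i => (1 - m i / μ (q ⁻¹' {i})) • μ.restrict (q ⁻¹' {i}),
    Measure.sum fun i => (1 - m i / ν (q ⁻¹' {i})) • ν.restrict (q ⁻¹' {i}), π, ?_, ?_, ?_, ?_⟩
  · rw [hfst, Measure.sum_add_sum]
    simp only [← add_smul]
    conv_rhs => rw [← sum_restrict_fibers μ hq]
    congr 1
    ext1 i
    rw [add_tsub_cancel_of_le (ENNReal.div_le_of_le_mul (by simp [hm])), one_smul]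
  · rw [hsnd, Measure.sum_add_sum]
    simp only [← add_smul]
    conv_rhs => rw [← sum_restrict_fibers ν hq]
    congr 1
    ext1 i
    rw [add_tsub_cancel_of_le (ENNReal.div_le_of_le_mul (by simp [hm])), one_smul]
  · rw [hπ, Measure.ae_sum_iff]
    intro i
    refine Measure.ae_smul_measure ?_ _
    rw [Measure.prod_restrict]
    filter_upwards [ae_restrict_mem ((hF i).prod (hF i))] with z hz
    exact (hz.1 : q z.1 = i).trans (hz.2 : q z.2 = i).symm
  · rw [Measure.sum_apply _ MeasurableSet.univ]
    congr 1
    ext1 i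
    rw [Measure.smul_apply, Measure.restrict_apply_univ, smul_eq_mul,
      ENNReal.sub_mul (fun _ _ => measure_ne_top _ _), one_mul]
    by_cases h : μ (q ⁻¹' {i}) = 0
    · simp [h]
    · rw [ENNReal.div_mul_cancel h (measure_ne_top _ _)]
      simp only [hm]
      rcases le_total (μ (q ⁻¹' {i})) (ν (q ⁻¹' {i})) with h' | h'
      · rw [min_eq_left h', tsub_self, tsub_eq_zero_of_le h']
      · rw [min_eq_right h']

/-- Matched points share a cell, so the matched part gives equal mass to both marginals on every
union of cells. Removing it therefore leaves the discrepancies of all coarser partitions unchanged.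
-/
lemma map_fst_apply_eq_map_snd_apply {π : Measure (α × α)} {q : α → ι} (hq : Measurable q)
    (h : ∀ᵐ z ∂π, q z.1 = q z.2) (B : Set ι) :
    π.map Prod.fst (q ⁻¹' B) = π.map Prod.snd (q ⁻¹' B) := by
  have hB : MeasurableSet (q ⁻¹' B) := hq B.to_countable.measurableSet
  rw [Measure.map_apply measurable_fst hB, Measure.map_apply measurable_snd hB]
  refine measure_congr ?_
  filter_upwards [h] with z hz
  change (q z.1 ∈ B) = (q z.2 ∈ B)
  rw [hz]

/-- Transport along a sequence of nested partitions: the mass that cannot be matched inside the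
cells of level `j + 1` travels at most as far as the cells of level `j` allow. -/
theorem exists_coupling_of_nested {q : ℕ → α → ι} (hq : ∀ k, Measurable (q k))
    (hnest : ∀ j k, j ≤ k → ∃ r : ι → ι, ∀ x, q j x = r (q k x))
    {c : α × α → ℝ≥0∞} {D : ℕ → ℝ≥0∞}
    (hD : ∀ k x y, q k x = q k y → c (x, y) ≤ D k) (i₀ : ι) (k : ℕ) :
    ∀ (μ ν : Measure α) [IsFiniteMeasure μ] [IsFiniteMeasure ν], μ Set.univ = ν Set.univ →
      (∀ᵐ x ∂μ, q 0 x = i₀) → (∀ᵐ x ∂ν, q 0 x = i₀) →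
      ∃ π : Measure (α × α), π.map Prod.fst = μ ∧ π.map Prod.snd = ν ∧
        ∫⁻ z, c z ∂π ≤ D k * μ Set.univ + ∑ j ∈ Finset.range k,
          D j * ∑' i, (μ (q (j + 1) ⁻¹' {i}) - ν (q (j + 1) ⁻¹' {i})) := by
  have hcost : ∀ (k : ℕ) (π : Measure (α × α)), (∀ᵐ z ∂π, q k z.1 = q k z.2) →
      ∫⁻ z, c z ∂π ≤ D k * π Set.univ := by
    intro k π h
    rw [← lintegral_const]
    exact lintegral_mono_ae (h.mono fun z hz => hD k _ _ hz)
  induction k with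
  | zero =>
    intro μ ν _ _ hmass hμ hν
    by_cases h0 : μ Set.univ = 0
    · have hν0 : ν = 0 := Measure.measure_univ_eq_zero.1 (hmass ▸ h0)
      have hμ0 : μ = 0 := Measure.measure_univ_eq_zero.1 h0
      exact ⟨0, by simp [hμ0], by simp [hν0], by simp⟩
    refine ⟨(μ Set.univ)⁻¹ • μ.prod ν, ?_, ?_, ?_⟩
    · rw [Measure.map_smul, Measure.map_fst_prod, smul_smul, ← hmass,
        ENNReal.inv_mul_cancel h0 (measure_ne_top _ _), one_smul]
    · rw [Measure.map_smul, Measure.map_snd_prod, smul_smul,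
        ENNReal.inv_mul_cancel h0 (measure_ne_top _ _), one_smul]
    · refine (hcost 0 _ (Measure.ae_smul_measure ?_ _)).trans ?_
      · filter_upwards [Measure.quasiMeasurePreserving_fst.ae hμ,
          Measure.quasiMeasurePreserving_snd.ae hν] with z h1 h2
        rw [h1, h2]
      · rw [Measure.smul_apply, smul_eq_mul, ← Set.univ_prod_univ, Measure.prod_prod, ← hmass,
          ← mul_assoc (μ Set.univ)⁻¹, ENNReal.inv_mul_cancel h0 (measure_ne_top _ _), one_mul]
        simp
  | succ k ih =>
    intro μ ν _ _ hmass hμ hν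
    -- Match inside the finest cells first; the induction hypothesis transports the remainders with
    -- one level fewer.
    obtain ⟨μ₁, ν₁, π₀, hμ₁, hν₁, hπ₀, hres⟩ := exists_matching μ ν (hq (k + 1))
    have hle1 : μ₁ ≤ μ := by rw [← hμ₁]; exact Measure.le_add_left le_rfl
    have hle2 : ν₁ ≤ ν := by rw [← hν₁]; exact Measure.le_add_left le_rfl
    have hle0 : π₀.map Prod.fst ≤ μ := by
      conv_rhs => rw [← hμ₁]
      exact Measure.le_add_right le_rfl
    have := isFiniteMeasure_of_le μ hle1
    have := isFiniteMeasure_of_le ν hle2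
    have := isFiniteMeasure_of_le μ hle0
    -- On a union of finest cells the matched part contributes the same amount `a` to both sides;
    -- its finiteness allows cancellation.
    have hcells : ∀ B : Set ι, ∃ a, a ≠ ∞ ∧
        μ (q (k + 1) ⁻¹' B) = a + μ₁ (q (k + 1) ⁻¹' B) ∧
        ν (q (k + 1) ⁻¹' B) = a + ν₁ (q (k + 1) ⁻¹' B) := by
      intro B
      refine ⟨_, measure_ne_top (π₀.map Prod.fst) (q (k + 1) ⁻¹' B), ?_, ?_⟩
      · conv_lhs => rw [← hμ₁]
        rfl
      · conv_lhs => rw [← hν₁]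
        rw [map_fst_apply_eq_map_snd_apply (hq _) hπ₀]
        rfl
    obtain ⟨π₁, h1, h2, h3⟩ := ih μ₁ ν₁ (by
      obtain ⟨a, ha, e1, e2⟩ := hcells Set.univ
      rw [Set.preimage_univ] at e1 e2
      rw [e1, e2] at hmass
      exact (ENNReal.add_right_inj ha).1 hmass)
      (hle1.absolutelyContinuous.ae_le hμ) (hle2.absolutelyContinuous.ae_le hν)
    refine ⟨π₀ + π₁, ?_, ?_, ?_⟩
    · rw [Measure.map_add _ _ measurable_fst, h1, hμ₁]
    · rw [Measure.map_add _ _ measurable_snd, h2, hν₁]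
    · have hπ₀mass : π₀ Set.univ ≤ μ Set.univ := by
        have := hle0 Set.univ
        rwa [Measure.map_apply measurable_fst MeasurableSet.univ, Set.preimage_univ] at this
      have hdiff : ∀ j ∈ Finset.range k, ∀ i,
          μ₁ (q (j + 1) ⁻¹' {i}) - ν₁ (q (j + 1) ⁻¹' {i}) =
            μ (q (j + 1) ⁻¹' {i}) - ν (q (j + 1) ⁻¹' {i}) := by
        intro j hj i
        obtain ⟨r, hr⟩ := hnest (j + 1) (k + 1) (by have := Finset.mem_range.1 hj; omega)
        have hset : q (j + 1) ⁻¹' {i} = q (k + 1) ⁻¹' (r ⁻¹' {i}) := by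
          ext x; simp [hr]
        obtain ⟨a, ha, e1, e2⟩ := hcells (r ⁻¹' {i})
        rw [hset, e1, e2, ENNReal.add_sub_add_eq_sub_left ha]
      -- The mass of `μ₁` is exactly the discrepancy at level `k + 1`, so the leading term of the
      -- induction hypothesis becomes the summand `j = k`.
      rw [lintegral_add_measure, Finset.sum_range_succ, ← hres, add_comm _ (D k * _), ← add_assoc]
      rw [← Finset.sum_congr rfl fun j hj => by rw [← tsum_congr (hdiff j hj)]]
      have hA := (hcost (k + 1) π₀ hπ₀).trans (mul_le_mul_right hπ₀mass (D (k + 1)))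
      rw [add_assoc]
      exact add_le_add hA h3

end Matching

/-! ### Dyadic partitions -/

section Dyadic

variable {d : ℕ} {R : ℝ}

/-- The index of the dyadic cell of side `4 R / 2 ^ k` that contains `y`. -/
def dyadicIndex (R : ℝ) (k : ℕ) (y : Euc d) (i : Fin d) : ℤ :=
  ⌊2 ^ k * ((y i + R) / (4 * R))⌋

/-- The indices of the dyadic cells of level `k` that meet the ball of radius `R`. -/
def dyadicCells (d k : ℕ) : Finset (Fin d → ℤ) := Fintype.piFinset fun _ => Finset.Ico 0 (2 ^ k)

lemma card_dyadicCells (d k : ℕ) : (dyadicCells d k).card = 2 ^ (k * d) := by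
  simp only [dyadicCells, Fintype.card_piFinset, Int.card_Ico, Finset.prod_const, Finset.card_univ,
    Fintype.card_fin, sub_zero, pow_mul]
  congr 1

lemma measurable_dyadicIndex (R : ℝ) (k : ℕ) :
    Measurable (dyadicIndex R k : Euc d → Fin d → ℤ) := by
  unfold dyadicIndex
  refine measurable_pi_lambda _ fun i => Int.measurable_floor.comp ?_
  fun_prop

/-- Halving cells `k - j` times scales the argument of the floor by `2^(k-j)`, and the floor of a
quotient by a natural number is the integer quotient of the floor. -/
lemma dyadicIndex_nested (R : ℝ) {j k : ℕ} (hjk : j ≤ k) :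
    ∃ r : (Fin d → ℤ) → Fin d → ℤ, ∀ y, dyadicIndex R j y = r (dyadicIndex R k y) := by
  refine ⟨fun m i => m i / (2 ^ (k - j) : ℕ), fun y => funext fun i => ?_⟩
  simp only [dyadicIndex]
  rw [← Int.floor_div_natCast]
  congr 1
  obtain ⟨l, rfl⟩ := Nat.exists_eq_add_of_le hjk
  rw [Nat.add_sub_cancel_left, pow_add]
  push_cast
  field_simp

lemma abs_coord_le_norm (y : Euc d) (i : Fin d) : |y i| ≤ ‖y‖ := by
  simpa using PiLp.norm_apply_le y i

lemma dyadicIndex_mem (hR : 0 < R) (k : ℕ) {y : Euc d} (hy : ‖y‖ ≤ R) :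
    dyadicIndex R k y ∈ dyadicCells d k := by
  rw [dyadicCells, Fintype.mem_piFinset]
  intro i
  have h := abs_le.1 ((abs_coord_le_norm y i).trans hy)
  rw [Finset.mem_Ico, dyadicIndex, Int.floor_nonneg, Int.floor_lt]
  constructor
  · exact mul_nonneg (by positivity) (div_nonneg (by linarith) (by linarith))
  · push_cast
    -- Coordinates in `[-R, R]` land in `[0, 1/2]`. A side of `4R` instead of `2R` keeps the
    -- endpoint `R` inside the half-open cell.
    have : (y i + R) / (4 * R) < 1 := by rw [div_lt_one (by linarith)]; linarith
    nlinarith [pow_pos (two_pos (α := ℝ)) k]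

lemma norm_sub_sq_le_of_dyadicIndex_eq (hR : 0 < R) (k : ℕ) {x y : Euc d}
    (h : dyadicIndex R k x = dyadicIndex R k y) : ‖x - y‖ ^ 2 ≤ 16 * R ^ 2 * d / 4 ^ k := by
  rw [EuclideanSpace.norm_sq_eq]
  calc ∑ i, ‖(x - y) i‖ ^ 2 ≤ ∑ _i : Fin d, 16 * R ^ 2 / 4 ^ k := by
        refine Finset.sum_le_sum fun i _ => ?_
        have h1 := Int.abs_sub_lt_one_of_floor_eq_floor (congrFun h i)
        rw [← mul_sub, ← sub_div, add_sub_add_right_eq_sub, abs_mul, abs_div,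
          abs_of_pos (by positivity : (0 : ℝ) < 2 ^ k), abs_of_pos (by linarith : 0 < 4 * R),
          ← mul_div_assoc, div_lt_one (by linarith)] at h1
        rw [Real.norm_eq_abs, PiLp.sub_apply, le_div_iff₀ (by positivity)]
        have h2 : (2 ^ k * |x i - y i|) ^ 2 ≤ (4 * R) ^ 2 :=
          pow_le_pow_left₀ (by positivity) h1.le 2
        have h4 : (4 : ℝ) ^ k = (2 ^ k) ^ 2 := by rw [← pow_mul, mul_comm, pow_mul]; norm_num
        rw [h4]
        linarith
    _ = _ := by simp; ring

/-- The multiscale bound for the squared `W₂` distance on the ball of radius `R`, with `k`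
dyadic scales. -/
def dyadicError (R : ℝ) (k : ℕ) (μ ν : Measure (Euc d)) : ℝ :=
  16 * R ^ 2 * d * ((4 ^ k)⁻¹ + ∑ j ∈ Finset.range k, (4 ^ j)⁻¹ *
    ∑ F ∈ dyadicCells d (j + 1),
      |μ.real (dyadicIndex R (j + 1) ⁻¹' {F}) - ν.real (dyadicIndex R (j + 1) ⁻¹' {F})|)

/-- The `W₂` distance is controlled by the masses of the dyadic cells. -/
theorem W2_sq_le_dyadic (hR : 0 < R) (μ ν : Measure (Euc d)) [IsProbabilityMeasure μ]
    [IsProbabilityMeasure ν] (hμ : ∀ᵐ y ∂μ, ‖y‖ ≤ R) (hν : ∀ᵐ y ∂ν, ‖y‖ ≤ R) (k : ℕ) :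
    W2 μ ν ^ 2 ≤ dyadicError R k μ ν := by
  unfold dyadicError
  -- The whole ball lies in a single cell of level `0`, as the transport lemma requires.
  have h0 : ∀ y : Euc d, ‖y‖ ≤ R → dyadicIndex R 0 y = 0 := by
    intro y hy
    have := dyadicIndex_mem hR 0 hy
    rw [dyadicCells, Fintype.mem_piFinset] at this
    ext i
    have := Finset.mem_Ico.1 (this i)
    simp only [pow_zero] at this
    simp only [Pi.zero_apply]
    omega
  obtain ⟨π, h1, h2, h3⟩ := exists_coupling_of_nested (q := dyadicIndex (d := d) R)
    (measurable_dyadicIndex R) (fun _ _ => dyadicIndex_nested R)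
    (c := fun z => ENNReal.ofReal (‖z.1 - z.2‖ ^ 2))
    (D := fun k => ENNReal.ofReal (16 * R ^ 2 * d / 4 ^ k))
    (fun k x y h => ENNReal.ofReal_le_ofReal (norm_sub_sq_le_of_dyadicIndex_eq hR k h)) 0 k μ ν
    (by simp) (hμ.mono h0) (hν.mono h0)
  have hW : ENNReal.ofReal (W2 μ ν ^ 2) ≤ ∫⁻ z, ENNReal.ofReal (‖z.1 - z.2‖ ^ 2) ∂π := by
    have := ewasserstein2_le_of_isCoupling (fun y : Euc d => ‖y‖) ⟨h1, h2⟩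
    rw [one_div, ENNReal.le_rpow_inv_iff (by norm_num)] at this
    refine le_trans ?_ this
    rw [show ENNReal.ofReal (W2 μ ν ^ 2) = ENNReal.ofReal (W2 μ ν) ^ (2 : ℝ) from
      ofReal_sq_eq_rpow ENNReal.toReal_nonneg]
    exact ENNReal.rpow_le_rpow ENNReal.ofReal_toReal_le (by norm_num)
  -- Outside the finite family of cells `μ` has no mass, so the truncated differences vanish
  -- whatever `ν` does there.
  have hcells : ∀ j, ∑' i, (μ (dyadicIndex R (j + 1) ⁻¹' {i}) - ν (dyadicIndex R (j + 1) ⁻¹' {i}))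
      ≤ ENNReal.ofReal (∑ F ∈ dyadicCells d (j + 1),
        |μ.real (dyadicIndex R (j + 1) ⁻¹' {F}) - ν.real (dyadicIndex R (j + 1) ⁻¹' {F})|) := by
    intro j
    rw [tsum_eq_sum (s := dyadicCells d (j + 1)), ENNReal.ofReal_sum_of_nonneg
      fun _ _ => abs_nonneg _]
    · refine Finset.sum_le_sum fun F _ => ?_
      rw [← ofReal_measureReal, ← ofReal_measureReal, ← ENNReal.ofReal_sub _ measureReal_nonneg]
      exact ENNReal.ofReal_le_ofReal (le_abs_self _)
    · intro F hF
      have : μ (dyadicIndex R (j + 1) ⁻¹' {F}) = 0 := by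
        refine measure_mono_null ?_ (ae_iff.1 hμ)
        intro y hy hyR
        exact hF ((hy : _ = F) ▸ dyadicIndex_mem hR (j + 1) hyR)
      rw [this, zero_tsub]
  refine (ENNReal.ofReal_le_ofReal_iff (by positivity)).1 ((hW.trans h3).trans ?_)
  rw [measure_univ, mul_one, mul_add, ENNReal.ofReal_add (by positivity) (by positivity),
    ← div_eq_mul_inv, Finset.mul_sum, ENNReal.ofReal_sum_of_nonneg fun _ _ => by positivity]
  refine add_le_add le_rfl (Finset.sum_le_sum fun j _ => ?_)
  rw [← mul_assoc, ← div_eq_mul_inv, ENNReal.ofReal_mul (by positivity)]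
  exact mul_le_mul_right (hcells j) _

end Dyadic

/-! ### The rate function -/

lemma rate_pos {m : ℕ} (hm : 1 ≤ m) (d : ℕ) : 0 < rate m d := by
  have hm' : (0 : ℝ) < m := by exact_mod_cast hm
  have hlog : 0 < Real.log (1 + m) := Real.log_pos (by linarith)
  unfold rate
  split_ifs <;> positivity

lemma rate_sq_of_le {m d : ℕ} (hm : 1 ≤ m) (hd : d ≤ 4) :
    rate m d ^ 2 = 4 * (Real.log (1 + m) / √m) := by
  have hm' : (0 : ℝ) < m := by exact_mod_cast hm
  have hlog : 0 < Real.log (1 + m) := Real.log_pos (by linarith)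
  have h1 : ((m : ℝ) ^ (-(1 / 4) : ℝ)) ^ 2 = (√m)⁻¹ := by
    rw [Real.sqrt_eq_rpow, ← Real.rpow_neg hm'.le, ← Real.rpow_natCast, ← Real.rpow_mul hm'.le]
    norm_num
  rw [rate, if_pos hd, mul_pow, mul_pow, ← Real.sqrt_eq_rpow, Real.sq_sqrt hlog.le, h1]
  ring

/-- The sum over dyadic scales in the low-dimensional case. -/
lemma dyadic_sum_le_of_le_four {d m : ℕ} (hm : 1 ≤ m) (hd : d ≤ 4) :
    ∃ k : ℕ, ((4 : ℝ) ^ k)⁻¹ + ∑ j ∈ Finset.range k, (4 ^ j)⁻¹ * √(2 ^ ((j + 1) * d) / m) ≤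
      5 * rate m d ^ 2 := by
  have hm' : (1 : ℝ) ≤ m := by exact_mod_cast hm
  have hs : 0 < √(m : ℝ) := Real.sqrt_pos.2 (by linarith)
  have hlog2 := Real.log_two_gt_d9
  have hlog : Real.log 2 ≤ Real.log (1 + m) := Real.log_le_log (by norm_num) (by linarith)
  -- About `log m` scales: enough that `4⁻ᵏ ≤ m^(-1/2)`. For `d ≤ 4` every scale costs at most
  -- `4/√m`, so the number of scales produces the logarithm in the rate.
  refine ⟨Nat.log 2 m + 1, ?_⟩
  set k := Nat.log 2 m + 1 with hk
  have h1 : ((4 : ℝ) ^ k)⁻¹ ≤ (√m)⁻¹ := by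
    refine inv_anti₀ hs ?_
    have h2 : (m : ℝ) < 2 ^ k := by exact_mod_cast Nat.lt_pow_succ_log_self (by norm_num) m
    have h3 : (2 : ℝ) ^ k ≤ 4 ^ k := pow_le_pow_left₀ (by norm_num) (by norm_num) k
    have h4 : √(m : ℝ) ≤ m := Real.sqrt_le_iff.2 ⟨by linarith, by nlinarith⟩
    linarith
  have hklog : (k : ℝ) ≤ 4 * Real.log (1 + m) := by
    have h2 : (2 : ℝ) ^ Nat.log 2 m ≤ m := by exact_mod_cast Nat.pow_log_le_self 2 (by omega)
    have h3 := Real.log_le_log (by positivity) h2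
    rw [Real.log_pow] at h3
    have h4 : Real.log m ≤ Real.log (1 + m) := Real.log_le_log (by linarith) (by linarith)
    rw [hk]
    push_cast
    have h5 : (0 : ℝ) ≤ Nat.log 2 m := by positivity
    nlinarith
  have hterm : ∀ j ∈ Finset.range k, ((4 : ℝ) ^ j)⁻¹ * √(2 ^ ((j + 1) * d) / m) ≤ 4 * (√m)⁻¹ := by
    intro j _
    have h2 : √((2 : ℝ) ^ ((j + 1) * d) / m) ≤ 4 ^ (j + 1) * (√m)⁻¹ := by
      rw [Real.sqrt_div (by positivity), div_eq_mul_inv]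
      refine mul_le_mul_of_nonneg_right (Real.sqrt_le_iff.2 ⟨by positivity, ?_⟩) (by positivity)
      calc (2 : ℝ) ^ ((j + 1) * d) ≤ 2 ^ ((j + 1) * 4) :=
            pow_le_pow_right₀ (by norm_num) (Nat.mul_le_mul_left _ hd)
        _ = (4 ^ (j + 1)) ^ 2 := by
            rw [show (4 : ℝ) = 2 ^ 2 by norm_num, ← pow_mul, ← pow_mul]; congr 1; ring
    calc _ ≤ ((4 : ℝ) ^ j)⁻¹ * (4 ^ (j + 1) * (√m)⁻¹) := by gcongr
      _ = 4 * (√m)⁻¹ := by rw [pow_succ]; field_simp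
  calc _ ≤ (√(m : ℝ))⁻¹ + ∑ j ∈ Finset.range k, 4 * (√m)⁻¹ := add_le_add h1 (Finset.sum_le_sum hterm)
    _ = (1 + 4 * k) * (√(m : ℝ))⁻¹ := by rw [Finset.sum_const, Finset.card_range, nsmul_eq_mul]; ring
    _ ≤ (20 * Real.log (1 + m)) * (√m)⁻¹ := by gcongr; linarith
    _ = 5 * rate m d ^ 2 := by rw [rate_sq_of_le hm hd]; ring

/-- The sum over dyadic scales in the high-dimensional case. -/
lemma dyadic_sum_le_of_four_lt {d m : ℕ} (hm : 1 ≤ m) (hd : 4 < d) :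
    ∃ k : ℕ, ((4 : ℝ) ^ k)⁻¹ + ∑ j ∈ Finset.range k, (4 ^ j)⁻¹ * √(2 ^ ((j + 1) * d) / m) ≤
      (1 + √(2 ^ d) / (√(2 ^ d) / 4 - 1)) * rate m d ^ 2 := by
  have hm' : (0 : ℝ) < m := by exact_mod_cast hm
  have hd' : (0 : ℝ) < d := by exact_mod_cast (by omega : 0 < d)
  have hs : 0 < √(m : ℝ) := Real.sqrt_pos.2 hm'
  set s := √((2 : ℝ) ^ d) with hsdef
  have hs4 : 4 < s := by
    refine Real.lt_sqrt_of_sq_lt ?_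
    calc (4 : ℝ) ^ 2 < 2 ^ 5 := by norm_num
      _ ≤ 2 ^ d := pow_le_pow_right₀ (by norm_num) hd
  -- The finest level with at most `m` cells, so `2ᵏ` is `m^(1/d)` up to a factor `2`, which the
  -- factor `2` in `rate` absorbs. As `d > 4`, the scales form a geometric series of ratio `s/4 > 1`
  -- dominated by its end, and `sᵏ ≤ √m` controls that.
  set k := Nat.log (2 ^ d) m with hk
  have hlow : ((2 : ℝ) ^ d) ^ k ≤ m := by
    exact_mod_cast Nat.pow_log_le_self (2 ^ d) (by omega : m ≠ 0)
  have hup : (m : ℝ) < ((2 : ℝ) ^ d) ^ (k + 1) := by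
    exact_mod_cast Nat.lt_pow_succ_log_self (Nat.one_lt_two_pow (by omega)) m
  refine ⟨k, ?_⟩
  have hrate : ((4 : ℝ) ^ k)⁻¹ ≤ rate m d ^ 2 := by
    have h1 : (m : ℝ) ^ (1 / d : ℝ) ≤ 2 ^ (k + 1) := by
      rw [one_div, Real.rpow_inv_le_iff_of_pos hm'.le (by positivity) hd', Real.rpow_natCast,
        ← pow_mul, mul_comm, pow_mul]
      exact hup.le
    have h2 : ((2 : ℝ) ^ k)⁻¹ ≤ rate m d := by
      rw [rate, if_neg (by omega), Real.rpow_neg hm'.le, ← div_eq_mul_inv,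
        le_div_iff₀ (by positivity), inv_mul_le_iff₀ (by positivity)]
      rwa [pow_succ] at h1
    calc ((4 : ℝ) ^ k)⁻¹ = (((2 : ℝ) ^ k)⁻¹) ^ 2 := by
          rw [inv_pow, ← pow_mul, mul_comm, pow_mul]; norm_num
      _ ≤ _ := pow_le_pow_left₀ (by positivity) h2 2
  have hsk : s ^ k ≤ √m := by
    rw [hsdef]
    refine Real.le_sqrt_of_sq_le ?_
    rwa [← pow_mul, mul_comm, pow_mul, Real.sq_sqrt (by positivity)]
  have hterm : ∀ j, ((4 : ℝ) ^ j)⁻¹ * √(2 ^ ((j + 1) * d) / m) = s * (√m)⁻¹ * (s / 4) ^ j := by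
    intro j
    have : √((2 : ℝ) ^ ((j + 1) * d)) = s ^ (j + 1) := by
      rw [Real.sqrt_eq_iff_eq_sq (by positivity) (by positivity), ← pow_mul, mul_comm (j + 1) 2,
        pow_mul s, hsdef, Real.sq_sqrt (by positivity), ← pow_mul, mul_comm]
    rw [Real.sqrt_div (by positivity), this, div_pow, pow_succ]
    field_simp
  simp only [hterm]
  rw [← Finset.mul_sum, geom_sum_eq (by intro h; linarith : s / 4 ≠ 1)]
  have hpos : 0 < s / 4 - 1 := by linarith
  have hgeo : s * (√m)⁻¹ * (((s / 4) ^ k - 1) / (s / 4 - 1)) ≤ s / (s / 4 - 1) * ((4 : ℝ) ^ k)⁻¹ := by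
    calc _ ≤ s * (√m)⁻¹ * ((s / 4) ^ k / (s / 4 - 1)) := by gcongr; linarith
      _ = s / (s / 4 - 1) * ((4 : ℝ) ^ k)⁻¹ * (s ^ k * (√m)⁻¹) := by rw [div_pow]; ring
      _ ≤ s / (s / 4 - 1) * ((4 : ℝ) ^ k)⁻¹ * 1 := by
          gcongr
          rwa [← div_eq_mul_inv, div_le_one hs]
      _ = _ := mul_one _
  calc _ ≤ ((4 : ℝ) ^ k)⁻¹ + s / (s / 4 - 1) * ((4 : ℝ) ^ k)⁻¹ := add_le_add le_rfl hgeo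
    _ = (1 + s / (s / 4 - 1)) * ((4 : ℝ) ^ k)⁻¹ := by ring
    _ ≤ _ := by gcongr

theorem exists_dyadic_sum_le_rate_sq (d : ℕ) :
    ∃ A : ℝ, 0 < A ∧ ∀ m : ℕ, 1 ≤ m → ∃ k : ℕ, ((4 : ℝ) ^ k)⁻¹ +
      ∑ j ∈ Finset.range k, (4 ^ j)⁻¹ * √(2 ^ ((j + 1) * d) / m) ≤ A * rate m d ^ 2 := by
  rcases le_or_gt d 4 with hd | hd
  · exact ⟨5, by norm_num, fun m hm => dyadic_sum_le_of_le_four hm hd⟩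
  · refine ⟨_, ?_, fun m hm => dyadic_sum_le_of_four_lt hm hd⟩
    have hs4 : 4 < √((2 : ℝ) ^ d) := by
      refine Real.lt_sqrt_of_sq_lt ?_
      calc (4 : ℝ) ^ 2 < 2 ^ 5 := by norm_num
        _ ≤ 2 ^ d := pow_le_pow_right₀ (by norm_num) hd
    have : 0 < √((2 : ℝ) ^ d) / 4 - 1 := by linarith
    positivity

/-! ### Mean deviations of sums of independent variables -/

/-- The mean absolute deviation is controlled by the variance. -/
lemma integral_abs_sub_integral_le {Ω : Type*} [MeasurableSpace Ω] {P : Measure Ω}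
    [IsProbabilityMeasure P] {X : Ω → ℝ} (hX : MemLp X 2 P) {b : ℝ} (hb : 0 < b) :
    ∫ ω, |X ω - ∫ ω', X ω' ∂P| ∂P ≤ (Var[X; P] / b + b) / 2 := by
  set c := ∫ ω', X ω' ∂P
  have hsub : MemLp (fun ω => X ω - c) 2 P := hX.sub (memLp_const c)
  rw [variance_eq_integral hX.aemeasurable]
  have hint : Integrable (fun ω => (X ω - c) ^ 2) P := hsub.integrable_sq
  calc ∫ ω, |X ω - c| ∂P ≤ ∫ ω, ((X ω - c) ^ 2 / b + b) / 2 ∂P := by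
        refine integral_mono (hsub.integrable (by norm_num)).abs
          (((hint.div_const b).add (integrable_const b)).div_const 2) fun ω => ?_
        change |X ω - c| ≤ ((X ω - c) ^ 2 / b + b) / 2
        -- The inequality of arithmetic and geometric means with a free scale `b`; it is sharp when
        -- `b` is the size of the deviation.
        have h : 2 * |X ω - c| * b ≤ (X ω - c) ^ 2 + b * b := by
          rw [← sq_abs]; nlinarith [sq_nonneg (|X ω - c| - b)]
        rw [div_add' _ _ _ hb.ne', div_div, le_div_iff₀ (by positivity)]
        linarith
    _ = _ := by
        rw [integral_div, integral_add (hint.div_const b) (integrable_const b), integral_div]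
        simp [c]

/-- The law of large numbers in mean, for independent bounded variables with a common mean. -/
lemma integral_abs_mean_sub_average_le {S : Type*} [MeasurableSpace S] {Q : Measure S}
    [IsProbabilityMeasure Q] {N : ℕ} (hN : 1 ≤ N) {V : Fin N → S → ℝ}
    (hV : ∀ i, Measurable (V i)) (hind : iIndepFun V Q) {B c : ℝ} (hB : 0 < B)
    (hb : ∀ i s, |V i s| ≤ B) (hc : ∀ i, ∫ s, V i s ∂Q = c) :
    ∫ s, |c - (N : ℝ)⁻¹ * ∑ i, V i s| ∂Q ≤ B / √N := by
  have hN' : (0 : ℝ) < N := by exact_mod_cast hN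
  have hmem : ∀ i, MemLp (V i) 2 Q := fun i =>
    MemLp.of_bound (hV i).aestronglyMeasurable B (Filter.Eventually.of_forall (hb i))
  have hvar : Var[fun s => (N : ℝ)⁻¹ * ∑ i, V i s; Q] ≤ B ^ 2 / N := by
    rw [variance_const_mul]
    have h1 := IndepFun.variance_sum (s := Finset.univ) (fun i _ => hmem i)
      (fun i _ j _ hij => hind.indepFun hij)
    rw [show (fun s => ∑ i, V i s) = ∑ i, V i by ext s; simp, h1]
    calc _ ≤ ((N : ℝ)⁻¹) ^ 2 * ∑ _i : Fin N, B ^ 2 := by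
          gcongr with i _
          refine (variance_le_expectation_sq (hV i).aestronglyMeasurable).trans ?_
          calc _ ≤ ∫ _s, B ^ 2 ∂Q := by
                refine integral_mono (hmem i).integrable_sq (integrable_const _) fun s => ?_
                exact sq_le_sq' (by have := abs_le.1 (hb i s); linarith)
                  (by have := abs_le.1 (hb i s); linarith)
            _ = B ^ 2 := by simp
      _ = B ^ 2 / N := by
          rw [Finset.sum_const, Finset.card_univ, Fintype.card_fin, nsmul_eq_mul]
          field_simp
  have hmemsum : MemLp (fun s => (N : ℝ)⁻¹ * ∑ i, V i s) 2 Q :=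
    (memLp_finsetSum _ fun i _ => hmem i).const_mul _
  have hmean : ∫ s, (N : ℝ)⁻¹ * ∑ i, V i s ∂Q = c := by
    rw [integral_const_mul, integral_finsetSum _ fun i _ => (hmem i).integrable (by norm_num),
      Finset.sum_congr rfl fun i _ => hc i]
    simp only [Finset.sum_const, Finset.card_univ, Fintype.card_fin, nsmul_eq_mul]
    field_simp
  have hs : 0 < √(N : ℝ) := Real.sqrt_pos.2 hN'
  -- `B / √N` is the bound on the standard deviation, so both halves of the estimate are at most
  -- this size.
  have h := integral_abs_sub_integral_le hmemsum (b := B / √N) (by positivity)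
  rw [hmean] at h
  simp only [abs_sub_comm c]
  refine h.trans ?_
  have h2 : B ^ 2 / N / (B / √N) = B / √N := by
    have := Real.sq_sqrt hN'.le
    field_simp
    rw [this]
  have h3 : Var[fun s => (N : ℝ)⁻¹ * ∑ i, V i s; Q] / (B / √N) ≤ B / √N := by
    calc _ ≤ B ^ 2 / N / (B / √N) := by gcongr
      _ = _ := h2
  linarith

/-! ### Empirical measures of independent samples -/

lemma avgMeasure_real_apply {ι α : Type*} [MeasurableSpace α] (J : Finset ι) (μ : ι → Measure α)
    [∀ j, IsFiniteMeasure (μ j)] (s : Set α) :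
    (avgMeasure J μ).real s = (J.card : ℝ)⁻¹ * ∑ j ∈ J, (μ j).real s := by
  rw [measureReal_def, avgMeasure, Measure.smul_apply, Measure.finsetSum_apply, smul_eq_mul,
    ENNReal.toReal_mul, ENNReal.toReal_inv, ENNReal.toReal_natCast,
    ENNReal.toReal_sum fun j _ => measure_ne_top _ _]
  rfl

section Empirical

variable {ι Ω α κ : Type*} [MeasurableSpace α] {Y : ι → Ω → α} {J : Finset ι}

/-- The empirical measure of the points `Y j (ω j)`, `j ∈ J`. -/
def empMeasure (J : Finset ι) (Y : ι → Ω → α) (ω : ι → Ω) : Measure α :=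
  avgMeasure J fun j => Measure.dirac (Y j (ω j))

lemma empMeasure_real_apply (ω : ι → Ω) {s : Set α} (hs : MeasurableSet s) :
    (empMeasure J Y ω).real s = (J.card : ℝ)⁻¹ * ∑ j ∈ J, s.indicator 1 (Y j (ω j)) := by
  rw [empMeasure, avgMeasure_real_apply]
  congr 1
  refine Finset.sum_congr rfl fun j _ => ?_
  rw [measureReal_def, Measure.dirac_apply' _ hs]
  by_cases h : Y j (ω j) ∈ s <;> simp [h]

variable [Fintype ι] [MeasurableSpace Ω] {P : Measure Ω} [IsProbabilityMeasure P]

/-- The empirical mass is an average of independent indicators, and an indicator has variance at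
most its mean. The scale `b` stays free so that one value can serve all cells of a level. -/
lemma integral_abs_sub_empMeasure_le (hY : ∀ j, Measurable (Y j)) (hJ : J.Nonempty) {s : Set α}
    (hs : MeasurableSet s) {b : ℝ} (hb : 0 < b) :
    ∫ ω, |(avgMeasure J fun j => P.map (Y j)).real s - (empMeasure J Y ω).real s|
        ∂(Measure.pi fun _ => P) ≤
      ((avgMeasure J fun j => P.map (Y j)).real s / (J.card * b) + b) / 2 := by
  classical
  have hprob : ∀ j, IsProbabilityMeasure (P.map (Y j)) := fun j =>
    Measure.isProbabilityMeasure_map (hY j).aemeasurable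
  have hJ0 : (0 : ℝ) < J.card := by exact_mod_cast hJ.card_pos
  -- Extension by zero off `J` turns the sum into one over the full product space, where the
  -- variance formula applies.
  set X : ι → Ω → ℝ := fun j ω => if j ∈ J then s.indicator 1 (Y j ω) else 0 with hX
  have hXm : ∀ j, Measurable (X j) := by
    intro j
    simp only [hX]
    split_ifs
    · exact (measurable_one.indicator hs).comp (hY j)
    · exact measurable_const
  have hX01 : ∀ j ω, 0 ≤ X j ω ∧ X j ω ≤ 1 := by
    intro j ω
    simp only [hX]
    split_ifs
    · by_cases h : Y j ω ∈ s <;> simp [h]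
    · simp
  have hXL : ∀ j, MemLp (X j) 2 P := fun j =>
    MemLp.of_bound (hXm j).aestronglyMeasurable 1 (Filter.Eventually.of_forall fun ω => by
      rw [Real.norm_eq_abs, abs_of_nonneg (hX01 j ω).1]; exact (hX01 j ω).2)
  have hXint : ∀ j ∈ J, ∫ ω, X j ω ∂P = (P.map (Y j)).real s := by
    intro j hj
    simp only [hX, if_pos hj]
    rw [measureReal_def, Measure.map_apply (hY j) hs, ← measureReal_def,
      ← integral_indicator_one (hY j hs)]
    rfl
  have hsum : ∀ ω : ι → Ω, (empMeasure J Y ω).real s = (J.card : ℝ)⁻¹ * ∑ j, X j (ω j) := by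
    intro ω
    rw [empMeasure_real_apply ω hs]
    simp only [hX, Finset.sum_ite_mem, Finset.univ_inter]
  have hmp : ∀ j, MeasurePreserving (Function.eval j) (Measure.pi fun _ : ι => P) P :=
    fun j => measurePreserving_eval _ j
  have hXL' : ∀ j, MemLp (fun ω : ι → Ω => X j (ω j)) 2 (Measure.pi fun _ => P) :=
    fun j => (hXL j).comp_measurePreserving (hmp j)
  have hmem : MemLp (fun ω : ι → Ω => (J.card : ℝ)⁻¹ * ∑ j, X j (ω j)) 2 (Measure.pi fun _ => P) :=
    (memLp_finsetSum _ fun j _ => hXL' j).const_mul _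
  have hmean : ∫ ω : ι → Ω, (J.card : ℝ)⁻¹ * ∑ j, X j (ω j) ∂(Measure.pi fun _ => P) =
      (avgMeasure J fun j => P.map (Y j)).real s := by
    rw [integral_const_mul, integral_finsetSum _ fun j _ => (hXL' j).integrable (by norm_num),
      avgMeasure_real_apply]
    congr 1
    rw [← Finset.sum_subset (Finset.subset_univ J)]
    · refine Finset.sum_congr rfl fun j hj => ?_
      rw [← hXint j hj]
      exact (integral_map (hmp j).measurable.aemeasurable
        (hXm j).aestronglyMeasurable).symm.trans (by rw [(hmp j).map_eq])
    · intro j _ hj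
      simp [hX, hj]
  have hvar : Var[fun ω : ι → Ω => (J.card : ℝ)⁻¹ * ∑ j, X j (ω j); Measure.pi fun _ => P] ≤
      (avgMeasure J fun j => P.map (Y j)).real s / J.card := by
    rw [variance_const_mul]
    have h1 := variance_sum_pi (μ := fun _ : ι => P) hXL
    rw [show (fun ω : ι → Ω => ∑ j, X j (ω j)) = ∑ j, fun ω : ι → Ω => X j (ω j) by ext ω; simp,
      h1, avgMeasure_real_apply]
    have h2 : ∑ j, Var[X j; P] ≤ ∑ j ∈ J, (P.map (Y j)).real s := by
      rw [← Finset.sum_subset (Finset.subset_univ J)]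
      · refine Finset.sum_le_sum fun j hj => ?_
        refine (variance_le_expectation_sq (hXm j).aestronglyMeasurable).trans ?_
        rw [← hXint j hj]
        refine integral_mono (hXL j).integrable_sq ((hXL j).integrable (by norm_num)) fun ω => ?_
        have := hX01 j ω
        change X j ω ^ 2 ≤ X j ω
        nlinarith
      · intro j _ hj
        have : X j = 0 := by ext ω; simp [hX, hj]
        rw [this, variance_zero]
    calc _ ≤ ((J.card : ℝ)⁻¹) ^ 2 * ∑ j ∈ J, (P.map (Y j)).real s := by gcongr
      _ = _ := by ring
  have h := integral_abs_sub_integral_le hmem hb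
  rw [hmean] at h
  simp only [hsum, abs_sub_comm ((avgMeasure J fun j => P.map (Y j)).real s)]
  refine h.trans ?_
  rw [← div_div]
  gcongr

lemma integrable_abs_sub_empMeasure (hY : ∀ j, Measurable (Y j)) {s : Set α}
    (hs : MeasurableSet s) :
    Integrable (fun ω => |(avgMeasure J fun j => P.map (Y j)).real s - (empMeasure J Y ω).real s|)
      (Measure.pi fun _ => P) := by
  refine Integrable.abs (Integrable.sub (integrable_const _) ?_)
  simp only [empMeasure_real_apply _ hs]
  refine (integrable_finsetSum _ fun j _ => ?_).const_mul _
  refine Integrable.of_bound (C := 1) ?_ ?_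
  · exact ((measurable_one.indicator hs).comp
      ((hY j).comp (measurable_pi_apply j))).aestronglyMeasurable
  · refine Filter.Eventually.of_forall fun ω => ?_
    by_cases h : Y j (ω j) ∈ s <;> simp [h]

/-- The expected total deviation of the empirical measure over finitely many cells. -/
lemma integral_sum_abs_sub_empMeasure_le [MeasurableSpace κ] [MeasurableSingletonClass κ]
    (hY : ∀ j, Measurable (Y j)) (hJ : J.Nonempty) {q : α → κ} (hq : Measurable q)
    {A : Finset κ} (hA : A.Nonempty) :
    ∫ ω, ∑ F ∈ A, |(avgMeasure J fun j => P.map (Y j)).real (q ⁻¹' {F}) -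
        (empMeasure J Y ω).real (q ⁻¹' {F})| ∂(Measure.pi fun _ => P) ≤ √(A.card / J.card) := by
  have hprob : ∀ j, IsProbabilityMeasure (P.map (Y j)) := fun j =>
    Measure.isProbabilityMeasure_map (hY j).aemeasurable
  have hf := isProbabilityMeasure_avgMeasure hJ (fun j => P.map (Y j)) fun j _ => hprob j
  have hJ0 : (0 : ℝ) < J.card := by exact_mod_cast hJ.card_pos
  have hA0 : (0 : ℝ) < A.card := by exact_mod_cast hA.card_pos
  -- This choice balances `1/(m b)` against `|A| b`, with `m` the number of points. The cell masses
  -- enter only through their total, which is at most `1`.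
  set b : ℝ := (√(A.card * J.card))⁻¹ with hb
  have hb0 : 0 < b := by positivity
  have hF : ∀ F, MeasurableSet (q ⁻¹' {F}) := fun F => hq (measurableSet_singleton F)
  have hint := fun F (_ : F ∈ A) => integrable_abs_sub_empMeasure (P := P) (J := J) hY (hF F)
  rw [integral_finsetSum _ hint]
  calc _ ≤ ∑ F ∈ A, ((avgMeasure J fun j => P.map (Y j)).real (q ⁻¹' {F}) / (J.card * b) + b) / 2 :=
        Finset.sum_le_sum fun F _ => integral_abs_sub_empMeasure_le hY hJ (hF F) hb0
    _ = ((∑ F ∈ A, (avgMeasure J fun j => P.map (Y j)).real (q ⁻¹' {F})) / (J.card * b) +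
          A.card * b) / 2 := by
        rw [← Finset.sum_div, Finset.sum_add_distrib, ← Finset.sum_div, Finset.sum_const,
          nsmul_eq_mul]
    _ ≤ (1 / (J.card * b) + A.card * b) / 2 := by
        gcongr
        rw [sum_measureReal_preimage_singleton A fun F _ => hF F]
        exact measureReal_le_one
    _ = √(A.card / J.card) := by
        have h1 : 1 / (J.card * b) = √(A.card / J.card) := by
          rw [hb, Real.sqrt_mul hA0.le, Real.sqrt_div hA0.le]
          have := Real.mul_self_sqrt hJ0.le
          field_simp
          nlinarith
        have h2 : A.card * b = √(A.card / J.card) := by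
          rw [hb, Real.sqrt_mul hA0.le, Real.sqrt_div hA0.le]
          have := Real.mul_self_sqrt hA0.le
          field_simp
          nlinarith
        rw [h1, h2]
        ring

end Empirical

/-! ### The expected error of an empirical measure -/

section DyadicError

variable {ι Ω : Type*} [Fintype ι] [MeasurableSpace Ω] {P : Measure Ω} [IsProbabilityMeasure P]
  {d : ℕ} {Y : ι → Ω → Euc d} {J : Finset ι}

lemma dyadicError_nonneg (R : ℝ) (k : ℕ) (μ ν : Measure (Euc d)) : 0 ≤ dyadicError R k μ ν := by
  unfold dyadicError
  positivity

lemma measurableSet_dyadicCell (R : ℝ) (k : ℕ) (F : Fin d → ℤ) :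
    MeasurableSet (dyadicIndex R k ⁻¹' {F} : Set (Euc d)) :=
  measurable_dyadicIndex R k (measurableSet_singleton F)

lemma integrable_dyadicError (hY : ∀ j, Measurable (Y j)) (R : ℝ) (k : ℕ) :
    Integrable (fun ω => dyadicError R k (avgMeasure J fun j => P.map (Y j)) (empMeasure J Y ω))
      (Measure.pi fun _ => P) := by
  unfold dyadicError
  refine ((integrable_const _).add (integrable_finsetSum _ fun j _ =>
    (integrable_finsetSum _ fun F _ => ?_).const_mul _)).const_mul _
  exact integrable_abs_sub_empMeasure hY (measurableSet_dyadicCell R (j + 1) F)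

lemma integral_dyadicError_le (hY : ∀ j, Measurable (Y j)) (hJ : J.Nonempty) (R : ℝ) (k : ℕ) :
    ∫ ω, dyadicError R k (avgMeasure J fun j => P.map (Y j)) (empMeasure J Y ω)
        ∂(Measure.pi fun _ => P) ≤
      16 * R ^ 2 * d * ((4 ^ k)⁻¹ + ∑ j ∈ Finset.range k,
        (4 ^ j)⁻¹ * √(2 ^ ((j + 1) * d) / J.card)) := by
  unfold dyadicError
  have hint : ∀ j, Integrable (fun ω => ∑ F ∈ dyadicCells d (j + 1),
      |(avgMeasure J fun j => P.map (Y j)).real (dyadicIndex R (j + 1) ⁻¹' {F}) -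
        (empMeasure J Y ω).real (dyadicIndex R (j + 1) ⁻¹' {F})|) (Measure.pi fun _ => P) :=
    fun j => integrable_finsetSum _ fun F _ =>
      integrable_abs_sub_empMeasure hY (measurableSet_dyadicCell R (j + 1) F)
  rw [integral_const_mul, integral_add (integrable_const _)
    (integrable_finsetSum _ fun j _ => (hint j).const_mul _),
    integral_finsetSum _ fun j _ => (hint j).const_mul _]
  simp only [integral_const_mul, integral_const, probReal_univ, one_smul]
  refine mul_le_mul_of_nonneg_left (add_le_add le_rfl (Finset.sum_le_sum fun j _ => ?_))
    (by positivity)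
  refine mul_le_mul_of_nonneg_left ?_ (by positivity)
  have hA : (dyadicCells d (j + 1)).Nonempty := by
    rw [← Finset.card_pos, card_dyadicCells]; positivity
  have := integral_sum_abs_sub_empMeasure_le (P := P) hY hJ (measurable_dyadicIndex R (j + 1)) hA
  rw [card_dyadicCells] at this
  exact_mod_cast this

end DyadicError

/-! ### Sample neighbourhoods -/

section Sample

variable {n d N : ℕ}

lemma mem_nbhd_self (xs : Fin N → Euc n) {δ : ℝ} (hδ : 0 ≤ δ) (i : Fin N) :
    i ∈ nbhd xs δ (xs i) := by
  simp [nbhd, hδ]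

lemma one_le_nbhdCount (xs : Fin N → Euc n) {δ : ℝ} (hδ : 0 ≤ δ) (i : Fin N) :
    1 ≤ nbhdCount xs δ (xs i) :=
  Finset.card_pos.2 ⟨i, mem_nbhd_self xs hδ i⟩

lemma measurableSet_nbhd_eq (δ : ℝ) (i : Fin N) (J : Finset (Fin N)) :
    MeasurableSet {xs : Fin N → Euc n | nbhd xs δ (xs i) = J} := by
  have : {xs : Fin N → Euc n | nbhd xs δ (xs i) = J} =
      ⋂ j, {xs : Fin N → Euc n | ‖xs j - xs i‖ ≤ δ ↔ j ∈ J} := by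
    ext xs
    simp [nbhd, Finset.ext_iff]
  rw [this]
  refine MeasurableSet.iInter fun j => ?_
  have h : MeasurableSet {xs : Fin N → Euc n | ‖xs j - xs i‖ ≤ δ} :=
    measurableSet_le (by fun_prop) measurable_const
  by_cases hj : j ∈ J
  · simpa [hj] using h
  · simp only [hj, iff_false]
    exact h.compl

/-- A function that depends on the neighbourhood of a sample point is measurable as soon as it is
measurable for every fixed nonempty neighbourhood. -/
lemma measurable_of_forall_nbhd {β γ : Type*} [MeasurableSpace β] [MeasurableSpace γ] {δ : ℝ}
    (hδ : 0 ≤ δ) (i : Fin N) {X : β → Fin N → Euc n} (hX : Measurable X) {g : Finset (Fin N) → β → γ}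
    (hg : ∀ J, J.Nonempty → Measurable (g J)) :
    Measurable fun b => g (nbhd (X b) δ (X b i)) b := by
  intro s hs
  have : (fun b => g (nbhd (X b) δ (X b i)) b) ⁻¹' s =
      ⋃ J ∈ {J : Finset (Fin N) | J.Nonempty}, ({b | nbhd (X b) δ (X b i) = J} ∩ g J ⁻¹' s) := by
    ext b
    simp only [Set.mem_preimage, Set.mem_iUnion, Set.mem_inter_iff, Set.mem_ofPred_eq, exists_prop]
    constructor
    · exact fun h => ⟨_, ⟨i, mem_nbhd_self _ hδ i⟩, rfl, h⟩
    · rintro ⟨J, -, rfl, h⟩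
      exact h
  rw [this]
  exact MeasurableSet.biUnion (Set.to_countable _) fun J hJ =>
    (hX (measurableSet_nbhd_eq δ i J)).inter (hg J hJ hs)

/-- A bound for the `W₂` error of the local empirical measure at the `i`-th sample point that is
affine in the masses of the dyadic cells; `a` is the anticipated size of the error and `k` the
number of scales, as functions of the number of neighbours. -/
def sampleBound {Ω : Type*} [MeasurableSpace Ω] (P : Measure Ω) (y : Euc n → Ω → Euc d) (R : ℝ)
    (a : ℕ → ℝ) (k : ℕ → ℕ) (J : Finset (Fin N)) (xs : Fin N → Euc n) (us : Fin N → Ω) : ℝ :=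
  (a J.card + dyadicError R (k J.card) (avgMeasure J fun j => lawAt P y (xs j))
    (empMeasure J (fun j => y (xs j)) us) / a J.card) / 2

lemma sampleBound_nonneg {Ω : Type*} [MeasurableSpace Ω] (P : Measure Ω) (y : Euc n → Ω → Euc d)
    (R : ℝ) {a : ℕ → ℝ} (k : ℕ → ℕ) {J : Finset (Fin N)} (ha : 0 < a J.card) (xs : Fin N → Euc n)
    (us : Fin N → Ω) : 0 ≤ sampleBound P y R a k J xs us := by
  unfold sampleBound
  have := dyadicError_nonneg R (k J.card) (avgMeasure J fun j => lawAt P y (xs j))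
    (empMeasure J (fun j => y (xs j)) us)
  positivity

variable {Ω : Type*} [MeasurableSpace Ω] {P : Measure Ω} [IsProbabilityMeasure P]
  {y : Euc n → Ω → Euc d}

lemma measurable_section (hy : Measurable (Function.uncurry y)) (x : Euc n) : Measurable (y x) :=
  hy.comp measurable_prodMk_left

lemma isProbabilityMeasure_lawAt (hy : Measurable (Function.uncurry y)) (x : Euc n) :
    IsProbabilityMeasure (lawAt P y x) :=
  Measure.isProbabilityMeasure_map (measurable_section hy x).aemeasurable

lemma measurable_lawAt_real (hy : Measurable (Function.uncurry y)) {s : Set (Euc d)}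
    (hs : MeasurableSet s) : Measurable fun x => (lawAt P y x).real s := by
  have : (fun x => (lawAt P y x).real s) =
      fun x => (P (Prod.mk x ⁻¹' (Function.uncurry y ⁻¹' s))).toReal := by
    ext x
    rw [measureReal_def, lawAt, Measure.map_apply (measurable_section hy x) hs]
    rfl
  rw [this]
  exact (measurable_measure_prodMk_left (hy hs)).ennreal_toReal

lemma measurable_sampleBound (hy : Measurable (Function.uncurry y)) (R : ℝ) (a : ℕ → ℝ)
    (k : ℕ → ℕ) (J : Finset (Fin N)) :
    Measurable fun z : (Fin N → Euc n) × (Fin N → Ω) => sampleBound P y R a k J z.1 z.2 := by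
  have := isProbabilityMeasure_lawAt (P := P) hy
  unfold sampleBound dyadicError
  refine (measurable_const.add (Measurable.div_const (Measurable.const_mul
    (measurable_const.add (Finset.measurable_sum _ fun j _ => Measurable.const_mul
      (Finset.measurable_sum _ fun F _ => ?_) _)) _) _)).div_const _
  have hF := measurableSet_dyadicCell (d := d) R (j + 1) F
  simp only [empMeasure_real_apply _ hF, avgMeasure_real_apply]
  refine Measurable.abs (Measurable.sub (Measurable.const_mul (Finset.measurable_sum _ fun l _ => ?_) _)
    (Measurable.const_mul (Finset.measurable_sum _ fun l _ => ?_) _))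
  · exact (measurable_lawAt_real hy hF).comp ((measurable_pi_apply l).comp measurable_fst)
  · have h : Measurable fun z : (Fin N → Euc n) × (Fin N → Ω) => y (z.1 l) (z.2 l) :=
      hy.comp (f := fun z : (Fin N → Euc n) × (Fin N → Ω) => (z.1 l, z.2 l)) (by fun_prop)
    exact (measurable_one.indicator hF).comp h

/-- The hypothesis `hk` makes the expected dyadic error at most `a²`, and `(a + a²/a)/2 = a`. -/
lemma lintegral_sampleBound_le (hy : Measurable (Function.uncurry y)) {R : ℝ} {a : ℕ → ℝ}
    {k : ℕ → ℕ} {J : Finset (Fin N)} (hJ : J.Nonempty) (ha : 0 < a J.card)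
    (hk : 16 * R ^ 2 * d * ((4 ^ k J.card)⁻¹ + ∑ j ∈ Finset.range (k J.card),
      (4 ^ j)⁻¹ * √(2 ^ ((j + 1) * d) / J.card)) ≤ a J.card ^ 2) (xs : Fin N → Euc n) :
    ∫⁻ us, ENNReal.ofReal (sampleBound P y R a k J xs us) ∂(Measure.pi fun _ => P) ≤
      ENNReal.ofReal (a J.card) := by
  have hY : ∀ j, Measurable (y (xs j)) := fun j => measurable_section hy _
  have hint := integrable_dyadicError (P := P) (J := J) hY R (k J.card)
  have hint' : Integrable (fun us => sampleBound P y R a k J xs us) (Measure.pi fun _ => P) :=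
    ((integrable_const _).add (hint.div_const _)).div_const _
  rw [← ofReal_integral_eq_lintegral_ofReal hint'
    (Filter.Eventually.of_forall fun us => sampleBound_nonneg P y R k ha xs us)]
  refine ENNReal.ofReal_le_ofReal ?_
  have h := (integral_dyadicError_le (P := P) hY hJ R (k J.card)).trans hk
  have e : ∫ us, sampleBound P y R a k J xs us ∂(Measure.pi fun _ => P) =
      (a J.card + (∫ us, dyadicError R (k J.card) (avgMeasure J fun j => P.map (y (xs j)))
        (empMeasure J (fun j => y (xs j)) us) ∂(Measure.pi fun _ => P)) / a J.card) / 2 := by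
    unfold sampleBound lawAt
    rw [integral_div, integral_add (integrable_const _) (hint.div_const _), integral_div]
    simp
  rw [e]
  have h2 : (∫ us, dyadicError R (k J.card) (avgMeasure J fun j => P.map (y (xs j)))
        (empMeasure J (fun j => y (xs j)) us) ∂(Measure.pi fun _ => P)) / a J.card ≤ a J.card := by
    rw [div_le_iff₀ ha, ← sq]
    exact h
  linarith

/-- From `W₂² ≤ dyadicError` and `2w ≤ a + w²/a`. Thus a bound in mean square becomes one in mean.
-/
lemma W2_le_sampleBound {R : ℝ} (hR : 0 < R) {a : ℕ → ℝ} (k : ℕ → ℕ) {J : Finset (Fin N)}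
    (hJ : J.Nonempty) (ha : 0 < a J.card) (hy : Measurable (Function.uncurry y))
    (xs : Fin N → Euc n) (us : Fin N → Ω) (h : ∀ j ∈ J, ∀ᵐ z ∂(lawAt P y (xs j)), ‖z‖ ≤ R)
    (h' : ∀ j ∈ J, ‖y (xs j) (us j)‖ ≤ R) :
    W2 (avgMeasure J fun j => lawAt P y (xs j)) (empMeasure J (fun j => y (xs j)) us) ≤
      sampleBound P y R a k J xs us := by
  have := isProbabilityMeasure_avgMeasure hJ (fun j => lawAt P y (xs j))
    fun j _ => isProbabilityMeasure_lawAt hy _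
  have : IsProbabilityMeasure (empMeasure J (fun j => y (xs j)) us) :=
    isProbabilityMeasure_avgMeasure hJ _ fun j _ => inferInstance
  have hW := W2_sq_le_dyadic hR (avgMeasure J fun j => lawAt P y (xs j))
    (empMeasure J (fun j => y (xs j)) us) (ae_avgMeasure h)
    (ae_avgMeasure fun j hj => (ae_dirac_iff (measurableSet_le measurable_norm
      measurable_const)).2 (h' j hj)) (k J.card)
  unfold sampleBound
  set w := W2 (avgMeasure J fun j => lawAt P y (xs j)) (empMeasure J (fun j => y (xs j)) us)
  have h2 : w ^ 2 / a J.card ≤ dyadicError R (k J.card) (avgMeasure J fun j => lawAt P y (xs j))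
    (empMeasure J (fun j => y (xs j)) us) / a J.card := by gcongr
  have h3 : 2 * w ≤ a J.card + w ^ 2 / a J.card := by
    rw [add_div' _ _ _ ha.ne', le_div_iff₀ ha]
    nlinarith [sq_nonneg (w - a J.card)]
  linarith

/-! ### Independent samples -/

variable {S : Type*} [MeasurableSpace S] {Q : Measure S} [IsProbabilityMeasure Q]
  {ν : Measure (Euc n)} [IsProbabilityMeasure ν] {X : Fin N → S → Euc n} {U : Fin N → S → Ω}

/-- Independent pairs with a product law can be regrouped: the vector of inputs is independent of
the vector of latent variables. This justifies freezing the inputs, and with them all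
neighbourhoods. -/
lemma map_sample_eq (hX : ∀ i, Measurable (X i)) (hU : ∀ i, Measurable (U i))
    (hind : iIndepFun (fun i s => (X i s, U i s)) Q)
    (hlaw : ∀ i, Q.map (fun s => (X i s, U i s)) = ν.prod P) :
    Q.map (fun s => ((fun i => X i s), (fun i => U i s))) =
      (Measure.pi fun _ : Fin N => ν).prod (Measure.pi fun _ : Fin N => P) := by
  have hXU : ∀ i, Measurable fun s => (X i s, U i s) := fun i => (hX i).prodMk (hU i)
  have h1 := (iIndepFun_iff_map_fun_eq_pi_map fun i => (hXU i).aemeasurable).1 hind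
  simp only [hlaw] at h1
  rw [← (measurePreserving_arrowProdEquivProdArrow (Euc n) Ω (Fin N) (fun _ => ν)
    (fun _ => P)).map_eq, ← h1, Measure.map_map (MeasurableEquiv.measurable _)
    (measurable_pi_lambda _ hXU)]
  rfl

/-- Conditioning on the inputs. -/
lemma lintegral_sample_le (hX : ∀ i, Measurable (X i)) (hU : ∀ i, Measurable (U i))
    (hind : iIndepFun (fun i s => (X i s, U i s)) Q)
    (hlaw : ∀ i, Q.map (fun s => (X i s, U i s)) = ν.prod P)
    {Ψ : (Fin N → Euc n) × (Fin N → Ω) → ℝ≥0∞} (hΨ : Measurable Ψ)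
    {B : (Fin N → Euc n) → ℝ≥0∞} (hB : Measurable B)
    (h : ∀ xs, ∫⁻ us, Ψ (xs, us) ∂(Measure.pi fun _ => P) ≤ B xs) :
    ∫⁻ s, Ψ ((fun i => X i s), (fun i => U i s)) ∂Q ≤ ∫⁻ s, B (fun i => X i s) ∂Q := by
  have hm := map_sample_eq hX hU hind hlaw
  have hX' : Measurable fun s i => X i s := measurable_pi_lambda _ hX
  have hXU : Measurable fun s => ((fun i => X i s), (fun i => U i s)) :=
    hX'.prodMk (measurable_pi_lambda _ hU)
  have hmX : Q.map (fun s i => X i s) = Measure.pi fun _ : Fin N => ν := by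
    rw [show (fun s i => X i s) = Prod.fst ∘ fun s => ((fun i => X i s), (fun i => U i s)) from rfl,
      ← Measure.map_map measurable_fst hXU, hm, Measure.map_fst_prod, measure_univ, one_smul]
  rw [← lintegral_map hΨ hXU, ← lintegral_map hB hX', hm, hmX, lintegral_prod _ hΨ.aemeasurable]
  exact lintegral_mono h

lemma measurable_rate_nbhdCount {δ : ℝ} (hδ : 0 ≤ δ) (i : Fin N) (d : ℕ) :
    Measurable fun xs : Fin N → Euc n => rate (nbhdCount xs δ (xs i)) d :=
  measurable_of_forall_nbhd hδ i measurable_id (g := fun J _ => rate J.card d)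
    fun _ _ => measurable_const

lemma integrable_rate_nbhdCount (hX : ∀ i, Measurable (X i)) {δ : ℝ} (hδ : 0 ≤ δ) (i : Fin N)
    (d : ℕ) : Integrable (fun s => rate (nbhdCount (fun j => X j s) δ (X i s)) d) Q := by
  -- Only the finitely many counts up to `N` occur, so a sum of all values is a crude bound.
  refine Integrable.of_bound (C := ∑ m ∈ Finset.range (N + 1), |rate m d|)
    ((measurable_rate_nbhdCount hδ i d).comp (measurable_pi_lambda _ hX)).aestronglyMeasurable
    (Filter.Eventually.of_forall fun s => ?_)
  rw [Real.norm_eq_abs]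
  refine Finset.single_le_sum (f := fun m => |rate m d|) (fun _ _ => abs_nonneg _)
    (Finset.mem_range.2 (Nat.lt_succ_of_le ?_))
  exact (Finset.card_le_univ _).trans (by simp)

/-- The expected bound for the local empirical error. -/
lemma integral_sampleBound_le (hy : Measurable (Function.uncurry y))
    (hX : ∀ i, Measurable (X i)) (hU : ∀ i, Measurable (U i))
    (hind : iIndepFun (fun i s => (X i s, U i s)) Q)
    (hlaw : ∀ i, Q.map (fun s => (X i s, U i s)) = ν.prod P) {R c : ℝ} {k : ℕ → ℕ} (hc : 0 < c)
    (hk : ∀ m : ℕ, 1 ≤ m → 16 * R ^ 2 * d * ((4 ^ k m)⁻¹ + ∑ j ∈ Finset.range (k m),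
      (4 ^ j)⁻¹ * √(2 ^ ((j + 1) * d) / m)) ≤ (c * rate m d) ^ 2) {δ : ℝ} (hδ : 0 ≤ δ)
    (i : Fin N) :
    Integrable (fun s => sampleBound P y R (fun m => c * rate m d) k
      (nbhd (fun j => X j s) δ (X i s)) (fun j => X j s) (fun j => U j s)) Q ∧
    ∫ s, sampleBound P y R (fun m => c * rate m d) k
      (nbhd (fun j => X j s) δ (X i s)) (fun j => X j s) (fun j => U j s) ∂Q ≤
      c * ∫ s, rate (nbhdCount (fun j => X j s) δ (X i s)) d ∂Q := by
  set Φ : (Fin N → Euc n) × (Fin N → Ω) → ℝ := fun z =>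
    sampleBound P y R (fun m => c * rate m d) k (nbhd z.1 δ (z.1 i)) z.1 z.2 with hΦ
  have hpos : ∀ xs : Fin N → Euc n, 0 < c * rate (nbhdCount xs δ (xs i)) d := fun xs =>
    mul_pos hc (rate_pos (one_le_nbhdCount xs hδ i) d)
  have hΦ0 : ∀ z, 0 ≤ Φ z := fun z => sampleBound_nonneg P y R k (hpos z.1) _ _
  have hΦm : Measurable Φ := measurable_of_forall_nbhd hδ i measurable_fst
    (g := fun J z => sampleBound P y R (fun m => c * rate m d) k J z.1 z.2)
    fun J _ => measurable_sampleBound hy R _ k J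
  have hXU : Measurable fun s => ((fun i => X i s), (fun i => U i s)) :=
    (measurable_pi_lambda _ hX).prodMk (measurable_pi_lambda _ hU)
  have hle := lintegral_sample_le hX hU hind hlaw (Ψ := fun z => ENNReal.ofReal (Φ z))
    hΦm.ennreal_ofReal (B := fun xs => ENNReal.ofReal (c * rate (nbhdCount xs δ (xs i)) d))
    ((measurable_rate_nbhdCount hδ i d).const_mul c).ennreal_ofReal
    fun xs => lintegral_sampleBound_le hy ⟨i, mem_nbhd_self xs hδ i⟩ (hpos xs)
      (hk _ (one_le_nbhdCount xs hδ i)) xs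
  have hrate := (integrable_rate_nbhdCount (Q := Q) hX hδ i d).const_mul c
  rw [← ofReal_integral_eq_lintegral_ofReal hrate
    (Filter.Eventually.of_forall fun s => (hpos _).le)] at hle
  have hint : Integrable (fun s => Φ ((fun i => X i s), (fun i => U i s))) Q := by
    refine ⟨(hΦm.comp hXU).aestronglyMeasurable, ?_⟩
    rw [hasFiniteIntegral_iff_ofReal (Filter.Eventually.of_forall fun s => hΦ0 _)]
    exact hle.trans_lt ENNReal.ofReal_lt_top
  refine ⟨hint, ?_⟩
  rw [← ofReal_integral_eq_lintegral_ofReal hint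
    (Filter.Eventually.of_forall fun s => hΦ0 _)] at hle
  rw [← integral_const_mul]
  exact (ENNReal.ofReal_le_ofReal_iff (integral_nonneg fun s => (hpos _).le)).1 hle

end Sample

/-! ### Regularity of the local loss -/

section Regularity

variable {n d N d₁ : ℕ} {lam M : ℝ}

lemma boundedLaw_avgMeasure {ι : Type*} {J : Finset ι} {μ : ι → Measure (Euc d)}
    (h : ∀ j ∈ J, BoundedLaw d₁ lam M (μ j)) : BoundedLaw d₁ lam M (avgMeasure J μ) :=
  ae_avgMeasure h

lemma measurableSet_max_genNorm_le (d₁ : ℕ) (lam r : ℝ) :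
    MeasurableSet {y : Euc d | max (genNorm d₁ lam y) ‖y‖ ≤ r} :=
  measurableSet_le ((measurable_genNorm _ _).max measurable_norm) measurable_const

lemma boundedLaw_dirac {a : Euc d} (h : max (genNorm d₁ lam a) ‖a‖ ≤ √M) :
    BoundedLaw d₁ lam M (Measure.dirac a) :=
  (ae_dirac_iff (measurableSet_max_genNorm_le _ _ _)).2 h

/-- Continuity in the sample points is needed at arbitrary configurations, not only at those obeying
the bound of the theorem; the constant here is made to fit the configuration at hand. -/
lemma boundedLaw_avg_dirac {J : Finset (Fin N)} {ys : Fin N → Euc d} {B : ℝ} (hB : ‖ys‖ ≤ B) :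
    BoundedLaw d₁ lam ((√(max lam 4) * B) ^ 2) (avgMeasure J fun j => Measure.dirac (ys j)) := by
  have hB0 : 0 ≤ B := (norm_nonneg _).trans hB
  have h1 : 1 ≤ √(max lam 4) := by
    rw [Real.one_le_sqrt]
    exact le_max_of_le_right (by norm_num)
  refine boundedLaw_avgMeasure fun j _ => boundedLaw_dirac ?_
  have hj : ‖ys j‖ ≤ B := (norm_le_pi_norm ys j).trans hB
  rw [Real.sqrt_sq (by positivity)]
  refine max_le ((genNorm_le d₁ lam _).trans (by gcongr)) (hj.trans ?_)
  exact le_mul_of_one_le_left hB0 h1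

lemma isProbabilityMeasure_avg_dirac {J : Finset (Fin N)} (hJ : J.Nonempty) (ys : Fin N → Euc d) :
    IsProbabilityMeasure (avgMeasure J fun j => Measure.dirac (ys j)) :=
  isProbabilityMeasure_avgMeasure hJ _ fun _ _ => inferInstance

lemma genW2_avg_dirac_le {J : Finset (Fin N)} (hJ : J.Nonempty) (ys zs : Fin N → Euc d) :
    genW2 d₁ lam (avgMeasure J fun j => Measure.dirac (ys j))
      (avgMeasure J fun j => Measure.dirac (zs j)) ≤ √(max lam 4) * ‖ys - zs‖ := by
  refine ENNReal.toReal_le_of_le_ofReal (by positivity) ?_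
  refine ewasserstein2_avgMeasure_le hJ _ _ fun j _ => ?_
  refine (ewasserstein2_dirac_le (genNorm_nonneg _ _) _ _).trans (ENNReal.ofReal_le_ofReal ?_)
  refine (genNorm_le d₁ lam _).trans ?_
  gcongr
  exact norm_le_pi_norm (ys - zs) j

/-- Pairing points with equal index shows that the distance is Lipschitz in the points. It yields
measurability of the local loss once the neighbourhood is fixed. -/
lemma continuous_genW2_avg_dirac (d₁ : ℕ) (hlam : 0 ≤ lam) {J : Finset (Fin N)}
    (hJ : J.Nonempty) :
    Continuous fun p : (Fin N → Euc d) × (Fin N → Euc d) =>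
      genW2 d₁ lam (avgMeasure J fun j => Measure.dirac (p.1 j))
        (avgMeasure J fun j => Measure.dirac (p.2 j)) := by
  refine (LipschitzWith.of_dist_le' (K := 2 * √(max lam 4)) fun p p' => ?_).continuous
  set B := max ‖p‖ ‖p'‖
  have hp := isProbabilityMeasure_avg_dirac (d := d) hJ
  have hb : ∀ ys : Fin N → Euc d, ‖ys‖ ≤ B → BoundedLaw d₁ lam ((√(max lam 4) * B) ^ 2)
    (avgMeasure J fun j => Measure.dirac (ys j)) := fun _ => boundedLaw_avg_dirac
  rw [Real.dist_eq]
  refine (abs_genW2_sub_le hlam (hb _ ((norm_fst_le p).trans (le_max_left _ _)))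
    (hb _ ((norm_fst_le p').trans (le_max_right _ _)))
    (hb _ ((norm_snd_le p).trans (le_max_left _ _)))
    (hb _ ((norm_snd_le p').trans (le_max_right _ _)))).trans ?_
  have h1 := genW2_avg_dirac_le (d₁ := d₁) (lam := lam) hJ p.1 p'.1
  have h2 := genW2_avg_dirac_le (d₁ := d₁) (lam := lam) hJ p.2 p'.2
  have h3 : ‖p.1 - p'.1‖ ≤ dist p p' := by rw [dist_eq_norm]; exact norm_fst_le (p - p')
  have h4 : ‖p.2 - p'.2‖ ≤ dist p p' := by rw [dist_eq_norm]; exact norm_snd_le (p - p')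
  have h5 := Real.sqrt_nonneg (max lam 4)
  nlinarith

lemma measurable_genW2_localEmp (d₁ : ℕ) (hlam : 0 ≤ lam) {δ : ℝ} (hδ : 0 ≤ δ) (i : Fin N)
    {β : Type*} [MeasurableSpace β] {X : β → Fin N → Euc n} {Y Y' : β → Fin N → Euc d}
    (hX : Measurable X) (hY : Measurable Y) (hY' : Measurable Y') :
    Measurable fun b => genW2 d₁ lam (localEmp (X b) (Y b) δ (X b i))
      (localEmp (X b) (Y' b) δ (X b i)) := by
  have h : ∀ J : Finset (Fin N), J.Nonempty → Measurable fun b =>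
      genW2 d₁ lam (avgMeasure J fun j => Measure.dirac (Y b j))
        (avgMeasure J fun j => Measure.dirac (Y' b j)) := fun J hJ =>
    (continuous_genW2_avg_dirac d₁ hlam hJ).measurable.comp
      (g := fun p : (Fin N → Euc d) × (Fin N → Euc d) =>
        genW2 d₁ lam (avgMeasure J fun j => Measure.dirac (p.1 j))
          (avgMeasure J fun j => Measure.dirac (p.2 j)))
      (f := fun b => (Y b, Y' b)) (hY.prodMk hY')
  simp only [localEmp_eq_avgMeasure]
  exact measurable_of_forall_nbhd hδ i hX h

lemma setIntegral_empInput {D : Set (Euc n)} {xs : Fin N → Euc n} (hxs : ∀ i, xs i ∈ D)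
    (g : Euc n → ℝ) : ∫ x in D, g x ∂(empInput xs) = (N : ℝ)⁻¹ * ∑ i, g (xs i) := by
  classical
  have hint : ∀ i ∈ (Finset.univ : Finset (Fin N)),
      Integrable g ((Measure.dirac (xs i)).restrict D) := fun i _ =>
    (integrable_dirac (by simp)).restrict
  rw [empInput, Measure.restrict_smul, ← Measure.sum_fintype,
    Measure.restrict_sum_of_countable, Measure.sum_fintype, integral_smul_measure,
    integral_finsetSum_measure hint, ENNReal.toReal_inv, ENNReal.toReal_natCast, smul_eq_mul]
  simp [setIntegral_dirac, hxs]

end Regularity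

/-! ### Pathwise error bounds -/

section Pathwise

variable {n d N d₁ : ℕ} {lam M L K δ : ℝ} {D : Set (Euc n)}
  {Ω : Type*} [MeasurableSpace Ω] {P : Measure Ω} [IsProbabilityMeasure P]
  {y : Euc n → Ω → Euc d}

/-- The error of the local empirical measure is at most the variation of the law over the
neighbourhood plus the sampling error. -/
lemma genW2_lawAt_localEmp_le (hlam : 0 ≤ lam) (hL : 0 ≤ L) (hδ : 0 ≤ δ)
    (hy : Measurable (Function.uncurry y))
    (hb : ∀ x ∈ D, BoundedLaw d₁ lam M (lawAt P y x))
    (hLip : ∀ x ∈ D, ∀ z ∈ D, genW2 d₁ lam (lawAt P y x) (lawAt P y z) ≤ L * ‖x - z‖)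
    (hK : IsComparisonConst d d₁ lam M K) {xs : Fin N → Euc n} (hxs : ∀ i, xs i ∈ D)
    {us : Fin N → Ω}
    (hus : ∀ i, max (genNorm d₁ lam (y (xs i) (us i))) ‖y (xs i) (us i)‖ ≤ √M) (i : Fin N) :
    genW2 d₁ lam (lawAt P y (xs i)) (localEmp xs (fun j => y (xs j) (us j)) δ (xs i)) ≤
      L * δ + K * W2 (avgMeasure (nbhd xs δ (xs i)) fun j => lawAt P y (xs j))
        (empMeasure (nbhd xs δ (xs i)) (fun j => y (xs j)) us) := by
  have hJ : (nbhd xs δ (xs i)).Nonempty := ⟨i, mem_nbhd_self xs hδ i⟩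
  have hp := isProbabilityMeasure_lawAt (P := P) hy
  have hp1 := isProbabilityMeasure_avgMeasure hJ (fun j => lawAt P y (xs j)) fun j _ => hp _
  have hp2 : IsProbabilityMeasure (localEmp xs (fun j => y (xs j) (us j)) δ (xs i)) :=
    isProbabilityMeasure_avg_dirac hJ _
  have hb1 : BoundedLaw d₁ lam M (avgMeasure (nbhd xs δ (xs i)) fun j => lawAt P y (xs j)) :=
    boundedLaw_avgMeasure fun j _ => hb _ (hxs j)
  have hb2 : BoundedLaw d₁ lam M (localEmp xs (fun j => y (xs j) (us j)) δ (xs i)) :=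
    boundedLaw_avgMeasure fun j _ => boundedLaw_dirac (hus j)
  -- The average of the neighbours' laws is the intermediate measure: the first leg is the bias
  -- `Lδ`, the second the sampling error.
  refine (genW2_triangle hlam (hb _ (hxs i)) hb1 hb2).trans (add_le_add ?_ ?_)
  · refine genW2_avgMeasure_le hlam hJ (fun j _ => hp _) (hb _ (hxs i)) (fun j _ => hb _ (hxs j))
      (by positivity) fun j hj => (hLip _ (hxs i) _ (hxs j)).trans ?_
    have : ‖xs j - xs i‖ ≤ δ := by simpa [nbhd] using hj
    rw [norm_sub_rev]
    gcongr
  · exact hK.2 _ _ hp1 hp2 hb1 hb2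

lemma abs_sq_sub_sq_le {a b r : ℝ} (ha : 0 ≤ a) (hb : 0 ≤ b) (ha' : a ≤ 2 * r) (hb' : b ≤ 2 * r) :
    |a ^ 2 - b ^ 2| ≤ 4 * r * |a - b| := by
  rw [sq_sub_sq, abs_mul, abs_of_nonneg (by positivity)]
  exact mul_le_mul_of_nonneg_right (by linarith) (abs_nonneg _)

variable {S : Type*} [MeasurableSpace S] {Q : Measure S}
  {ν : Measure (Euc n)} {X : Fin N → S → Euc n} {U : Fin N → S → Ω}

/-- The bound holds almost surely for each fixed input; Fubini for `ν ⊗ P` transfers it to random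
inputs. -/
lemma ae_sample_bounded (hD : MeasurableSet D) (hνD : ∀ᵐ x ∂ν, x ∈ D) [SFinite ν]
    (hy : Measurable (Function.uncurry y))
    (hb : ∀ x ∈ D, BoundedLaw d₁ lam M (lawAt P y x))
    (hX : ∀ i, Measurable (X i)) (hU : ∀ i, Measurable (U i))
    (hlaw : ∀ i, Q.map (fun s => (X i s, U i s)) = ν.prod P) :
    ∀ᵐ s ∂Q, ∀ i, X i s ∈ D ∧
      max (genNorm d₁ lam (y (X i s) (U i s))) ‖y (X i s) (U i s)‖ ≤ √M := by
  rw [ae_all_iff]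
  intro i
  have hset : MeasurableSet {z : Euc n × Ω | z.1 ∈ D ∧
      max (genNorm d₁ lam (y z.1 z.2)) ‖y z.1 z.2‖ ≤ √M} :=
    (measurable_fst hD).inter (hy (measurableSet_max_genNorm_le _ _ _))
  have h : ∀ᵐ z ∂(ν.prod P), z.1 ∈ D ∧ max (genNorm d₁ lam (y z.1 z.2)) ‖y z.1 z.2‖ ≤ √M := by
    rw [Measure.ae_prod_iff_ae_ae hset]
    filter_upwards [hνD] with x hx
    filter_upwards [ae_of_ae_map (measurable_section hy x).aemeasurable (hb x hx)] with ω hω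
    exact ⟨hx, hω⟩
  rw [← hlaw i] at h
  exact ae_of_ae_map ((hX i).prodMk (hU i)).aemeasurable h

end Pathwise

/-! ### The error bound -/

section Main

variable {n d N d₁ : ℕ} {lam M L K δ : ℝ} {D : Set (Euc n)}
  {Ω Ω' : Type*} [MeasurableSpace Ω] {P : Measure Ω} [IsProbabilityMeasure P]
  [MeasurableSpace Ω'] {P' : Measure Ω'} [IsProbabilityMeasure P']
  {y : Euc n → Ω → Euc d} {y' : Euc n → Ω' → Euc d}

/-- The Lipschitz hypotheses also supply the measurability in `x` that the integral over `D` needs.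
-/
lemma continuousOn_genW2_lawAt (hlam : 0 ≤ lam)
    (hy : Measurable (Function.uncurry y)) (hy' : Measurable (Function.uncurry y'))
    (hb : ∀ x ∈ D, BoundedLaw d₁ lam M (lawAt P y x))
    (hb' : ∀ x ∈ D, BoundedLaw d₁ lam M (lawAt P' y' x))
    (hLip : ∀ x ∈ D, ∀ z ∈ D, genW2 d₁ lam (lawAt P y x) (lawAt P y z) ≤ L * ‖x - z‖)
    (hLip' : ∀ x ∈ D, ∀ z ∈ D, genW2 d₁ lam (lawAt P' y' x) (lawAt P' y' z) ≤ L * ‖x - z‖) :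
    ContinuousOn (fun x => genW2 d₁ lam (lawAt P y x) (lawAt P' y' x)) D := by
  have hp := isProbabilityMeasure_lawAt (P := P) hy
  have hp' := isProbabilityMeasure_lawAt (P := P') hy'
  refine (LipschitzOnWith.of_dist_le' (K := 2 * L) fun x hx z hz => ?_).continuousOn
  rw [Real.dist_eq, dist_eq_norm]
  have := abs_genW2_sub_le hlam (hb x hx) (hb z hz) (hb' x hx) (hb' z hz)
  linarith [hLip x hx z hz, hLip' x hx z hz]

lemma genW2_sq_le (hlam : 0 ≤ lam) (hM : 0 ≤ M) {μ μ' : Measure (Euc d)} [IsProbabilityMeasure μ]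
    [IsProbabilityMeasure μ'] (h : BoundedLaw d₁ lam M μ) (h' : BoundedLaw d₁ lam M μ') :
    genW2 d₁ lam μ μ' ^ 2 ≤ 4 * M := by
  calc _ ≤ (2 * √M) ^ 2 := pow_le_pow_left₀ (genW2_nonneg _ _) (genW2_le hlam h h') 2
    _ = 4 * M := by rw [mul_pow, Real.sq_sqrt hM]; norm_num

variable {S : Type*} [MeasurableSpace S] {Q : Measure S} [IsProbabilityMeasure Q]
  {ν : Measure (Euc n)} {X : Fin N → S → Euc n} {U : Fin N → S → Ω}
  {U' : Fin N → S → Ω'}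

lemma localLoss_eq {xs : Fin N → Euc n} (hxs : ∀ i, xs i ∈ D) (ys ys' : Fin N → Euc d) :
    localLoss d₁ lam D δ xs ys ys' = (N : ℝ)⁻¹ * ∑ i,
      genW2 d₁ lam (localEmp xs ys δ (xs i)) (localEmp xs ys' δ (xs i)) ^ 2 :=
  setIntegral_empInput hxs _

lemma avgRate_eq {xs : Fin N → Euc n} (hxs : ∀ i, xs i ∈ D) :
    avgRate d D δ xs = (N : ℝ)⁻¹ * ∑ i, rate (nbhdCount xs δ (xs i)) d :=
  setIntegral_empInput hxs _

lemma abs_average_le {N : ℕ} (hN : 1 ≤ N) {f : Fin N → ℝ} {B : ℝ} (h : ∀ i, |f i| ≤ B) :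
    |(N : ℝ)⁻¹ * ∑ i, f i| ≤ B := by
  have hN' : (0 : ℝ) < N := by exact_mod_cast hN
  rw [abs_mul, abs_of_pos (inv_pos.2 hN'), inv_mul_le_iff₀ hN']
  refine (Finset.abs_sum_le_sum_abs _ _).trans ((Finset.sum_le_sum fun i _ => h i).trans ?_)
  simp

lemma integrable_localLoss (hlam : 0 ≤ lam) (hM : 0 ≤ M) (hN : 1 ≤ N) (hδ : 0 ≤ δ)
    (hy : Measurable (Function.uncurry y)) (hy' : Measurable (Function.uncurry y'))
    (hX : ∀ i, Measurable (X i)) (hU : ∀ i, Measurable (U i)) (hU' : ∀ i, Measurable (U' i))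
    (hae : ∀ᵐ s ∂Q, ∀ i, X i s ∈ D ∧
      max (genNorm d₁ lam (y (X i s) (U i s))) ‖y (X i s) (U i s)‖ ≤ √M)
    (hae' : ∀ᵐ s ∂Q, ∀ i, X i s ∈ D ∧
      max (genNorm d₁ lam (y' (X i s) (U' i s))) ‖y' (X i s) (U' i s)‖ ≤ √M) :
    Integrable (fun s => localLoss d₁ lam D δ (fun i => X i s)
        (fun i => y (X i s) (U i s)) (fun i => y' (X i s) (U' i s))) Q := by
  have hYm : Measurable fun s i => y (X i s) (U i s) :=
    measurable_pi_lambda _ fun i => hy.comp ((hX i).prodMk (hU i))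
  have hYm' : Measurable fun s i => y' (X i s) (U' i s) :=
    measurable_pi_lambda _ fun i => hy'.comp ((hX i).prodMk (hU' i))
  have hg : Measurable fun s => (N : ℝ)⁻¹ * ∑ i, genW2 d₁ lam
      (localEmp (fun i => X i s) (fun i => y (X i s) (U i s)) δ (X i s))
      (localEmp (fun i => X i s) (fun i => y' (X i s) (U' i s)) δ (X i s)) ^ 2 :=
    (Finset.measurable_sum _ fun i _ => (measurable_genW2_localEmp d₁ hlam hδ i
      (measurable_pi_lambda _ hX) hYm hYm').pow_const 2).const_mul _
  refine (Integrable.of_bound hg.aestronglyMeasurable (4 * M) ?_).congr ?_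
  · filter_upwards [hae, hae'] with s hs hs'
    refine abs_average_le hN fun i => ?_
    have hJ : (nbhd (fun i => X i s) δ (X i s)).Nonempty := ⟨i, mem_nbhd_self _ hδ i⟩
    have h1 : IsProbabilityMeasure
        (localEmp (fun i => X i s) (fun i => y (X i s) (U i s)) δ (X i s)) :=
      isProbabilityMeasure_avg_dirac hJ _
    have h2 : IsProbabilityMeasure
        (localEmp (fun i => X i s) (fun i => y' (X i s) (U' i s)) δ (X i s)) :=
      isProbabilityMeasure_avg_dirac hJ _
    rw [abs_of_nonneg (sq_nonneg _)]
    exact genW2_sq_le hlam hM (boundedLaw_avgMeasure fun j _ => boundedLaw_dirac (hs j).2)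
      (boundedLaw_avgMeasure fun j _ => boundedLaw_dirac (hs' j).2)
  · filter_upwards [hae] with s hs
    exact (localLoss_eq (fun i => (hs i).1) _ _).symm

/-- The difference between the loss with the true laws, averaged over the sample inputs, and the
local loss. -/
lemma abs_average_sub_localLoss_le (hlam : 0 ≤ lam) (hL : 0 ≤ L) (hδ : 0 ≤ δ)
    (hy : Measurable (Function.uncurry y)) (hy' : Measurable (Function.uncurry y'))
    (hb : ∀ x ∈ D, BoundedLaw d₁ lam M (lawAt P y x))
    (hb' : ∀ x ∈ D, BoundedLaw d₁ lam M (lawAt P' y' x))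
    (hLip : ∀ x ∈ D, ∀ z ∈ D, genW2 d₁ lam (lawAt P y x) (lawAt P y z) ≤ L * ‖x - z‖)
    (hLip' : ∀ x ∈ D, ∀ z ∈ D, genW2 d₁ lam (lawAt P' y' x) (lawAt P' y' z) ≤ L * ‖x - z‖)
    (hK : IsComparisonConst d d₁ lam M K) {xs : Fin N → Euc n} (hxs : ∀ i, xs i ∈ D)
    {us : Fin N → Ω} {us' : Fin N → Ω'}
    (hus : ∀ i, max (genNorm d₁ lam (y (xs i) (us i))) ‖y (xs i) (us i)‖ ≤ √M)
    (hus' : ∀ i, max (genNorm d₁ lam (y' (xs i) (us' i))) ‖y' (xs i) (us' i)‖ ≤ √M)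
    {T T' : Fin N → ℝ}
    (hT : ∀ i, W2 (avgMeasure (nbhd xs δ (xs i)) fun j => lawAt P y (xs j))
        (empMeasure (nbhd xs δ (xs i)) (fun j => y (xs j)) us) ≤ T i)
    (hT' : ∀ i, W2 (avgMeasure (nbhd xs δ (xs i)) fun j => lawAt P' y' (xs j))
        (empMeasure (nbhd xs δ (xs i)) (fun j => y' (xs j)) us') ≤ T' i) :
    |(N : ℝ)⁻¹ * ∑ i, genW2 d₁ lam (lawAt P y (xs i)) (lawAt P' y' (xs i)) ^ 2 -
      localLoss d₁ lam D δ xs (fun i => y (xs i) (us i)) (fun i => y' (xs i) (us' i))| ≤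
    (N : ℝ)⁻¹ * ∑ i, 4 * √M * (2 * (L * δ) + K * (T i + T' i)) := by
  rw [localLoss_eq hxs, ← mul_sub, ← Finset.sum_sub_distrib, abs_mul,
    abs_of_nonneg (by positivity : (0 : ℝ) ≤ (N : ℝ)⁻¹)]
  refine mul_le_mul_of_nonneg_left ((Finset.abs_sum_le_sum_abs _ _).trans
    (Finset.sum_le_sum fun i _ => ?_)) (by positivity)
  have hJ : (nbhd xs δ (xs i)).Nonempty := ⟨i, mem_nbhd_self xs hδ i⟩
  have hp := isProbabilityMeasure_lawAt (P := P) hy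
  have hp' := isProbabilityMeasure_lawAt (P := P') hy'
  have h1 : IsProbabilityMeasure (localEmp xs (fun i => y (xs i) (us i)) δ (xs i)) :=
    isProbabilityMeasure_avg_dirac hJ _
  have h2 : IsProbabilityMeasure (localEmp xs (fun i => y' (xs i) (us' i)) δ (xs i)) :=
    isProbabilityMeasure_avg_dirac hJ _
  have hb1 : BoundedLaw d₁ lam M (localEmp xs (fun i => y (xs i) (us i)) δ (xs i)) :=
    boundedLaw_avgMeasure fun j _ => boundedLaw_dirac (hus j)
  have hb2 : BoundedLaw d₁ lam M (localEmp xs (fun i => y' (xs i) (us' i)) δ (xs i)) :=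
    boundedLaw_avgMeasure fun j _ => boundedLaw_dirac (hus' j)
  refine (abs_sq_sub_sq_le (genW2_nonneg _ _) (genW2_nonneg _ _)
    (genW2_le hlam (hb _ (hxs i)) (hb' _ (hxs i))) (genW2_le hlam hb1 hb2)).trans ?_
  refine mul_le_mul_of_nonneg_left ?_ (by positivity)
  refine (abs_genW2_sub_le hlam (hb _ (hxs i)) hb1 (hb' _ (hxs i)) hb2).trans ?_
  have e1 := genW2_lawAt_localEmp_le hlam hL hδ hy hb hLip hK hxs hus i
  have e2 := genW2_lawAt_localEmp_le hlam hL hδ hy' hb' hLip' hK hxs hus' i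
  have e3 := mul_le_mul_of_nonneg_left (hT i) hK.1.le
  have e4 := mul_le_mul_of_nonneg_left (hT' i) hK.1.le
  linarith

/-- The sampling error of the inputs. -/
lemma integral_abs_fieldW2Sq_sub_average_le (hlam : 0 ≤ lam) (hM : 0 < M) (hN : 1 ≤ N)
    (hD : MeasurableSet D) (hy : Measurable (Function.uncurry y))
    (hy' : Measurable (Function.uncurry y'))
    (hb : ∀ x ∈ D, BoundedLaw d₁ lam M (lawAt P y x))
    (hb' : ∀ x ∈ D, BoundedLaw d₁ lam M (lawAt P' y' x))
    (hcont : ContinuousOn (fun x => genW2 d₁ lam (lawAt P y x) (lawAt P' y' x)) D)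
    (hX : ∀ i, Measurable (X i)) (hindX : iIndepFun X Q) (hlawX : ∀ i, Q.map (X i) = ν)
    (hXD : ∀ᵐ s ∂Q, ∀ i, X i s ∈ D) :
    Integrable (fun s => |fieldW2Sq d₁ lam D ν (lawAt P y) (lawAt P' y') -
      (N : ℝ)⁻¹ * ∑ i, genW2 d₁ lam (lawAt P y (X i s)) (lawAt P' y' (X i s)) ^ 2|) Q ∧
    ∫ s, |fieldW2Sq d₁ lam D ν (lawAt P y) (lawAt P' y') -
      (N : ℝ)⁻¹ * ∑ i, genW2 d₁ lam (lawAt P y (X i s)) (lawAt P' y' (X i s)) ^ 2| ∂Q ≤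
      4 * M / √N := by
  classical
  have hp := isProbabilityMeasure_lawAt (P := P) hy
  have hp' := isProbabilityMeasure_lawAt (P := P') hy'
  -- Continuity and boundedness are available only on `D`; extension by zero is globally measurable
  -- and agrees with the loss at almost every sample.
  set G : Euc n → ℝ := D.indicator fun x => genW2 d₁ lam (lawAt P y x) (lawAt P' y' x) ^ 2 with hG
  have hGm : Measurable G := by
    rw [hG, ← Set.piecewise_eq_indicator]
    exact (hcont.pow 2).measurable_piecewise continuousOn_const hD
  have hGb : ∀ x, |G x| ≤ 4 * M := by
    intro x
    by_cases hx : x ∈ D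
    · rw [hG, Set.indicator_of_mem hx, abs_of_nonneg (sq_nonneg _)]
      exact genW2_sq_le hlam hM.le (hb x hx) (hb' x hx)
    · rw [hG, Set.indicator_of_notMem hx, abs_zero]
      positivity
  have hmean : ∀ i, ∫ s, G (X i s) ∂Q = fieldW2Sq d₁ lam D ν (lawAt P y) (lawAt P' y') := by
    intro i
    rw [← integral_map (hX i).aemeasurable hGm.aestronglyMeasurable, hlawX i, hG,
      integral_indicator hD]
    rfl
  have hV := fun i => hGm.comp (hX i)
  have hmain := integral_abs_mean_sub_average_le hN (V := fun i s => G (X i s)) hV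
    (hindX.comp (fun _ => G) fun _ => hGm) (B := 4 * M) (by positivity) (fun i s => hGb _) hmean
  have hint : Integrable (fun s => |fieldW2Sq d₁ lam D ν (lawAt P y) (lawAt P' y') -
      (N : ℝ)⁻¹ * ∑ i, G (X i s)|) Q := by
    refine ((integrable_const _).sub (Integrable.of_bound (C := 4 * M) ?_
      (Filter.Eventually.of_forall fun s => abs_average_le hN fun i => hGb _))).abs
    exact ((Finset.measurable_sum _ fun i _ => hV i).const_mul _).aestronglyMeasurable
  have hcongr : (fun s => |fieldW2Sq d₁ lam D ν (lawAt P y) (lawAt P' y') -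
      (N : ℝ)⁻¹ * ∑ i, G (X i s)|) =ᵐ[Q] fun s =>
      |fieldW2Sq d₁ lam D ν (lawAt P y) (lawAt P' y') - (N : ℝ)⁻¹ * ∑ i,
        genW2 d₁ lam (lawAt P y (X i s)) (lawAt P' y' (X i s)) ^ 2| := by
    filter_upwards [hXD] with s hs
    rw [Finset.sum_congr rfl fun i _ => Set.indicator_of_mem (hs i) _]
  exact ⟨hint.congr hcongr, (integral_congr_ae hcongr).symm.trans_le hmain⟩

end Main

end

theorem theorem2p3 (d : ℕ) :
    ∃ C : ℝ, 0 < C ∧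
      ∀ (n d₁ : ℕ) (_ : d₁ ≤ d) (lam M L : ℝ) (_ : 0 ≤ lam) (_ : 0 < M) (_ : 0 ≤ L)
        -- the input domain and the input distribution
        (D : Set (Euc n)) (_ : MeasurableSet D)
        (ν : Measure (Euc n)) (_ : IsProbabilityMeasure ν) (_ : ∀ᵐ x ∂ν, x ∈ D)
        -- the two random fields `y(x; ω)` and `ŷ(x; ω̂)`
        (Ω : Type u) (_ : MeasurableSpace Ω) (P : Measure Ω) (_ : IsProbabilityMeasure P)
        (y : Euc n → Ω → Euc d) (_ : Measurable (Function.uncurry y))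
        (Ω' : Type v) (_ : MeasurableSpace Ω') (P' : Measure Ω') (_ : IsProbabilityMeasure P')
        (y' : Euc n → Ω' → Euc d) (_ : Measurable (Function.uncurry y'))
        -- uniform boundedness
        (_ : ∀ x ∈ D, BoundedLaw d₁ lam M (lawAt P y x))
        (_ : ∀ x ∈ D, BoundedLaw d₁ lam M (lawAt P' y' x))
        -- Lipschitz dependence of the laws on the input
        (_ : ∀ x ∈ D, ∀ z ∈ D, genW2 d₁ lam (lawAt P y x) (lawAt P y z) ≤ L * ‖x - z‖)
        (_ : ∀ x ∈ D, ∀ z ∈ D, genW2 d₁ lam (lawAt P' y' x) (lawAt P' y' z) ≤ L * ‖x - z‖),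
      -- a comparison constant exists, and the error bound holds with any of them
      (∃ K : ℝ, IsComparisonConst d d₁ lam M K) ∧
      ∀ (K : ℝ) (_ : IsComparisonConst d d₁ lam M K)
        (N : ℕ) (_ : 1 ≤ N) (δ : ℝ) (_ : 0 ≤ δ)
        -- the samples: inputs `X i`, latent variables `U i` and `U' i`
        (S : Type w) (_ : MeasurableSpace S) (Q : Measure S) (_ : IsProbabilityMeasure Q)
        (X : Fin N → S → Euc n) (U : Fin N → S → Ω) (U' : Fin N → S → Ω')
        (_ : ∀ i, Measurable (X i)) (_ : ∀ i, Measurable (U i)) (_ : ∀ i, Measurable (U' i))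
        -- the pairs `(X i, U i)` are i.i.d. with law `ν ⊗ P`, and likewise for `U'`
        (_ : iIndepFun (fun i s => (X i s, U i s)) Q)
        (_ : ∀ i, Q.map (fun s => (X i s, U i s)) = ν.prod P)
        (_ : iIndepFun (fun i s => (X i s, U' i s)) Q)
        (_ : ∀ i, Q.map (fun s => (X i s, U' i s)) = ν.prod P'),
      -- all integrals in the bound exist
      IntegrableOn (fun x => genW2 d₁ lam (lawAt P y x) (lawAt P' y' x) ^ 2) D ν ∧
      Integrable (fun s => localLoss d₁ lam D δ (fun i => X i s)
        (fun i => y (X i s) (U i s)) (fun i => y' (X i s) (U' i s))) Q ∧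
      Integrable (fun s => avgRate d D δ (fun i => X i s)) Q ∧
      -- the error bound
      ∫ s, |fieldW2Sq d₁ lam D ν (lawAt P y) (lawAt P' y')
          - localLoss d₁ lam D δ (fun i => X i s)
              (fun i => y (X i s) (U i s)) (fun i => y' (X i s) (U' i s))| ∂Q
        ≤ 4 * M / Real.sqrt N
          + 8 * C * K * M * ∫ s, avgRate d D δ (fun i => X i s) ∂Q
          + 8 * Real.sqrt M * L * δ := by
  obtain ⟨A, hA, hAk⟩ := exists_dyadic_sum_le_rate_sq d
  choose! k hk using hAk
  -- The square root of `16 (d + 1) A`, where `16 d` comes from the cell diameters. Replacing `d` by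
  -- `d + 1` keeps the constant positive for `d = 0`.
  refine ⟨4 * √((d + 1) * A), by positivity, ?_⟩
  intro n d₁ _ lam M L hlam hM hL D hD ν _ hνD Ω _ P _ y hy Ω' _ P' _ y' hy' hb hb' hLip hLip'
  refine ⟨exists_isComparisonConst, ?_⟩
  intro K hK N hN δ hδ S _ Q _ X U U' hX hU hU' hind hlaw hind' hlaw'
  set C : ℝ := 4 * √((d + 1) * A) with hC
  have hN' : (0 : ℝ) < N := by exact_mod_cast hN
  have hp := isProbabilityMeasure_lawAt (P := P) hy
  have hp' := isProbabilityMeasure_lawAt (P := P') hy'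
  have hM2 : √M ^ 2 = M := Real.sq_sqrt hM.le
  have hsM : 0 < √M := Real.sqrt_pos.2 hM
  have hc : 0 < C * √M := by positivity
  have hscale : ∀ m : ℕ, 1 ≤ m → 16 * √M ^ 2 * d * ((4 ^ k m)⁻¹ + ∑ j ∈ Finset.range (k m),
      (4 ^ j)⁻¹ * √(2 ^ ((j + 1) * d) / m)) ≤ (C * √M * rate m d) ^ 2 := by
    intro m hm
    calc _ ≤ 16 * √M ^ 2 * (d + 1) * (A * rate m d ^ 2) :=
          mul_le_mul (by gcongr; linarith) (hk m hm) (by positivity) (by positivity)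
      _ = _ := by
          have : √((d + 1 : ℝ) * A) ^ 2 = (d + 1) * A := Real.sq_sqrt (by positivity)
          rw [mul_pow, mul_pow, hC, mul_pow, this]
          ring
  have hae := ae_sample_bounded hD hνD hy hb hX hU hlaw
  have hae' := ae_sample_bounded hD hνD hy' hb' hX hU' hlaw'
  have hXD : ∀ᵐ s ∂Q, ∀ i, X i s ∈ D := hae.mono fun s hs i => (hs i).1
  have hcont := continuousOn_genW2_lawAt hlam hy hy' hb hb' hLip hLip'
  have hlawX : ∀ i, Q.map (X i) = ν := by
    intro i
    rw [show X i = Prod.fst ∘ fun s => (X i s, U i s) from rfl,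
      ← Measure.map_map measurable_fst ((hX i).prodMk (hU i)), hlaw i, Measure.map_fst_prod,
      measure_univ, one_smul]
  have hindX : iIndepFun X Q := hind.comp (fun _ => Prod.fst) fun _ => measurable_fst
  have hlocal := integrable_localLoss hlam hM.le hN hδ hy hy' hX hU hU' hae hae'
  have hrate := fun i => integrable_rate_nbhdCount (Q := Q) hX hδ i d
  have havg : (fun s => (N : ℝ)⁻¹ * ∑ i, rate (nbhdCount (fun j => X j s) δ (X i s)) d)
      =ᵐ[Q] fun s => avgRate d D δ (fun i => X i s) := by
    filter_upwards [hXD] with s hs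
    exact (avgRate_eq hs).symm
  have havgint := ((integrable_finsetSum Finset.univ fun i _ => hrate i).const_mul
    (N : ℝ)⁻¹).congr havg
  have havgval : ∫ s, avgRate d D δ (fun i => X i s) ∂Q =
      (N : ℝ)⁻¹ * ∑ i, ∫ s, rate (nbhdCount (fun j => X j s) δ (X i s)) d ∂Q := by
    rw [← integral_congr_ae havg, integral_const_mul, integral_finsetSum _ fun i _ => hrate i]
  refine ⟨?_, hlocal, havgint, ?_⟩
  · refine Integrable.of_bound ((hcont.pow 2).aestronglyMeasurable hD) (4 * M) ?_
    filter_upwards [ae_restrict_mem hD] with x hx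
    rw [Real.norm_eq_abs, abs_of_nonneg (sq_nonneg _)]
    exact genW2_sq_le hlam hM.le (hb x hx) (hb' x hx)
  obtain ⟨hZint, hZ⟩ := integral_abs_fieldW2Sq_sub_average_le (N := N) hlam hM hN hD hy hy' hb hb'
    hcont hX hindX hlawX hXD
  have hT := integral_sampleBound_le hy hX hU hind hlaw hc hscale hδ
  have hT' := integral_sampleBound_le hy' hX hU' hind' hlaw' hc hscale hδ
  set T : Fin N → S → ℝ := fun i s => sampleBound P y (√M) (fun m => C * √M * rate m d) k
    (nbhd (fun j => X j s) δ (X i s)) (fun j => X j s) (fun j => U j s)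
  set T' : Fin N → S → ℝ := fun i s => sampleBound P' y' (√M) (fun m => C * √M * rate m d) k
    (nbhd (fun j => X j s) δ (X i s)) (fun j => X j s) (fun j => U' j s)
  have hTi : ∀ i, Integrable (T i) Q := fun i => (hT i).1
  have hTi' : ∀ i, Integrable (T' i) Q := fun i => (hT' i).1
  have hKT : ∀ i, Integrable (fun s => K * (T i s + T' i s)) Q := fun i =>
    ((hTi i).add (hTi' i)).const_mul K
  have hTT : ∀ i, Integrable (fun s => 4 * √M * (2 * (L * δ) + K * (T i s + T' i s))) Q := fun i =>
    ((integrable_const _).add (hKT i)).const_mul _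
  have hTTint : Integrable (fun s => (N : ℝ)⁻¹ *
      ∑ i, 4 * √M * (2 * (L * δ) + K * (T i s + T' i s))) Q :=
    (integrable_finsetSum _ fun i _ => hTT i).const_mul _
  have hpath : ∀ᵐ s ∂Q, |fieldW2Sq d₁ lam D ν (lawAt P y) (lawAt P' y')
          - localLoss d₁ lam D δ (fun i => X i s)
              (fun i => y (X i s) (U i s)) (fun i => y' (X i s) (U' i s))| ≤
      |fieldW2Sq d₁ lam D ν (lawAt P y) (lawAt P' y') - (N : ℝ)⁻¹ * ∑ i,
        genW2 d₁ lam (lawAt P y (X i s)) (lawAt P' y' (X i s)) ^ 2| +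
      (N : ℝ)⁻¹ * ∑ i, 4 * √M * (2 * (L * δ) + K * (T i s + T' i s)) := by
    filter_upwards [hae, hae'] with s hs hs'
    have hpos : ∀ i, 0 < C * √M * rate (nbhd (fun j => X j s) δ (X i s)).card d := fun i =>
      mul_pos hc (rate_pos (one_le_nbhdCount (fun j => X j s) hδ i) d)
    -- The intermediate value is the average over the sample inputs of the loss with the true laws.
    refine (abs_sub_le _ _ _).trans (add_le_add le_rfl ?_)
    refine abs_average_sub_localLoss_le hlam hL hδ hy hy' hb hb' hLip hLip' hK
      (fun i => (hs i).1) (us := fun i => U i s) (us' := fun i => U' i s) (fun i => (hs i).2)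
      (fun i => (hs' i).2) (fun i => ?_) fun i => ?_
    · exact W2_le_sampleBound hsM k ⟨i, mem_nbhd_self (fun j => X j s) hδ i⟩ (hpos i) hy _ _
        (fun j _ => (hb _ (hs j).1).norm_le) fun j _ => (le_max_right _ _).trans (hs j).2
    · exact W2_le_sampleBound hsM k ⟨i, mem_nbhd_self (fun j => X j s) hδ i⟩ (hpos i) hy' _ _
        (fun j _ => (hb' _ (hs j).1).norm_le) fun j _ => (le_max_right _ _).trans (hs' j).2
  -- Each of the two fields contributes `Lδ + K C √M h`; the prefactor `4√M` turns the sum into `8√M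
  -- L δ + 8 C K M h`.
  have hTTval : ∀ i, ∫ s, 4 * √M * (2 * (L * δ) + K * (T i s + T' i s)) ∂Q ≤
      8 * √M * L * δ +
        8 * C * K * M * ∫ s, rate (nbhdCount (fun j => X j s) δ (X i s)) d ∂Q := by
    intro i
    rw [integral_const_mul, integral_add (integrable_const _) (hKT i), integral_const_mul K,
      integral_add (hTi i) (hTi' i)]
    simp only [integral_const, probReal_univ, one_smul]
    have h1 := mul_le_mul_of_nonneg_left (add_le_add (hT i).2 (hT' i).2)
      (by have := hK.1; positivity : 0 ≤ 4 * √M * K)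
    calc _ = 8 * √M * L * δ + 4 * √M * K * ((∫ s, T i s ∂Q) + ∫ s, T' i s ∂Q) := by ring
      _ ≤ _ := add_le_add le_rfl h1
      _ = 8 * √M * L * δ + 8 * C * K * √M ^ 2 *
            ∫ s, rate (nbhdCount (fun j => X j s) δ (X i s)) d ∂Q := by ring
      _ = _ := by rw [hM2]
  calc _ ≤ ∫ s, (|fieldW2Sq d₁ lam D ν (lawAt P y) (lawAt P' y') - (N : ℝ)⁻¹ * ∑ i,
        genW2 d₁ lam (lawAt P y (X i s)) (lawAt P' y' (X i s)) ^ 2| +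
      (N : ℝ)⁻¹ * ∑ i, 4 * √M * (2 * (L * δ) + K * (T i s + T' i s))) ∂Q :=
        integral_mono_ae ((integrable_const _).sub hlocal).abs (hZint.add hTTint) hpath
    _ ≤ 4 * M / √N + (N : ℝ)⁻¹ * ∑ i, (8 * √M * L * δ +
        8 * C * K * M * ∫ s, rate (nbhdCount (fun j => X j s) δ (X i s)) d ∂Q) := by
        rw [integral_add hZint hTTint, integral_const_mul, integral_finsetSum _ fun i _ => hTT i]
        gcongr with i _
        exact hTTval i
    _ = _ := by
        rw [havgval, Finset.sum_add_distrib, ← Finset.mul_sum Finset.univ _ (8 * C * K * M),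
          Finset.sum_const, Finset.card_univ, Fintype.card_fin, nsmul_eq_mul]
        field_simp
        ring
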